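/- Let $r,m,p$ be non-negative integers and let $\mathcal H_2=\mathcal H_2^{p\times m}(\mathbb C^+)$ be the Hardy space of analytic functions $F:\mathbb C^+\to\mathbb C^{p\times m}$ on the open right half-plane with $\sup_{\xi>0}\int_{-\infty}^{\infty}\|F(\xi+i\omega)\|_F^2\,d\omega<\infty$, with the inner product $$\langle F,G\rangle=\frac1{2\pi}\int_{-\infty}^{\infty}\operatorname{tr}\bigl(F(i\omega)^*G(i\omega)\bigr)\,d\omega ,$$ where $F(i\,\cdot)$ and $G(i\,\cdot)$ are the boundary values on the imaginary axis (the $L^2$ limits of $F(\xi+i\,\cdot)$, $G(\xi+i\,\cdot)$ as $\xi\to0^+$). Let $\Sigma=\Sigma^-_{r,m,p}(\mathbb C)\subset\mathcal H_2$ be the set of functions $s\mapsto C(sI-A)^{-1}B$ with $A\in\mathbb C^{r\times r}$ Hurwitz, $B\in\mathbb C^{r\times m}$, $C\in\mathbb C^{p\times r}$ and $(A,B,C)$ a minimal realization (no realization of the same rational function has order less than $r$). For $G\in\Sigma$ let $T_G\Sigma\subset\mathcal H_2$ be the tangent space, i.e. the set of velocities $\gamma'(0)$ of smooth curves $\gamma:(-\varepsilon,\varepsilon)\to\mathcal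 H_2$ with values in $\Sigma$ and $\gamma(0)=G$, and let $N_G\Sigma=(T_G\Sigma)^\perp$ be the normal space. Let $H\in\mathcal H_2$, and let $\hat H_k,\hat H_{k+1}\in\Sigma$ be two consecutive iterates of the iterative rational Krylov algorithm (IRKA) for $H$, where $\hat H_k$ has pairwise distinct poles; that is, $\hat H_k(s)=\sum_{i=1}^r\frac{c_ib_i^*}{s-\lambda_i}$ with $b_i\in\mathbb C^m$, $c_i\in\mathbb C^p$ and pairwise distinct $\lambda_i\in\mathbb C$, and for $i=1,\dots,r$ $$H(-\overline{\lambda_i})b_i=\hat H_{k+1}(-\overline{\lambda_i})b_i,\qquad c_i^*H(-\overline{\lambda_i})=c_i^*\hat H_{k+1}(-\overline{\lambda_i}),\qquad c_i^*H'(-\overline{\lambda_i})b_i=c_i^*\hat H_{k+1}'(-\overline{\lambda_i})b_i .$$ Then $$H-\hat H_{k+1}\perp T_{\hat H_k}\Sigma ,$$ i.e. $\hat H_{k+1}$ is an orthogonal projection of $H$ onto $\Sigma$ along the normal space of $\Sigma$ at $\hat H_k$: $\hat H_{k+1}\in\Sigma$ and $H-\hat H_{k+1}\in N_{\hat H_k}\Sigma$.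 -/

import Mathlib

open MeasureTheory Complex Filter Topology
open scoped ENNReal ComplexConjugate Matrix

/-! Boundary values of scalar Hardy functions. -/

theorem hilbert_limit {E : Type*} [NormedAddCommGroup E] [CompleteSpace E]
    (L : ℝ → E) (M : ℝ) (hM : ∀ x, 0 < x → ‖L x‖ ^ 2 ≤ M)
    (hL : ∀ x y, 0 < x → 0 < y →
      ‖L x - L y‖ ^ 2 = ‖L x‖ ^ 2 + ‖L y‖ ^ 2 - 2 * ‖L ((x + y) / 2)‖ ^ 2) :
    ∃ g : E, Tendsto L (𝓝[>] 0) (𝓝 g) ∧ ∀ x, 0 < x → ‖L x‖ ≤ ‖g‖ := by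
  set n : ℝ → ℝ := fun x => ‖L x‖ ^ 2 with hn
  have mid : ∀ x y, 0 < x → 0 < y → 2 * n ((x + y) / 2) ≤ n x + n y := by
    intro x y hx hy
    have := hL x y hx hy
    have h2 : 0 ≤ ‖L x - L y‖ ^ 2 := by positivity
    simp only [hn]; linarith
  have anti : ∀ x y, 0 < x → x < y → n y ≤ n x := by
    intro x y hx hxy
    by_contra! hlt
    set h := y - x with hh
    have key : ∀ k : ℕ, n x + k * (n y - n x) ≤ n (x + k * h) ∧
        n y - n x ≤ n (x + (k + 1 : ℕ) * h) - n (x + k * h) := by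
      intro k
      induction k with
      | zero => simp [hh]
      | succ k ih =>
        have hk : (0 : ℝ) ≤ k * h := by positivity
        have e := mid (x + k * h) (x + (k + 2 : ℕ) * h) (by positivity) (by positivity)
        have e2 : (x + k * h + (x + (k + 2 : ℕ) * h)) / 2 = x + (k + 1 : ℕ) * h := by
          push_cast; ring
        rw [e2] at e
        refine ⟨?_, ?_⟩
        · push_cast at ih ⊢; linarith [ih.1, ih.2]
        · have e3 : k + 1 + 1 = k + 2 := rfl
          rw [e3]; linarith [ih.2]
    obtain ⟨k, hk⟩ := exists_nat_gt ((M - n x) / (n y - n x))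
    have hpos : 0 < n y - n x := by linarith
    rw [div_lt_iff₀ hpos] at hk
    have h1 := (key k).1
    have hh0 : 0 < h := by simp [hh, hxy]
    have h2 := hM (x + k * h) (by positivity)
    simp only [hn] at *
    linarith
  set S := n '' Set.Ioi 0
  have Sb : BddAbove S := ⟨M, by rintro _ ⟨x, hx, rfl⟩; exact hM x hx⟩
  have Sn : S.Nonempty := ⟨n 1, 1, by simp, rfl⟩
  have le_sup : ∀ x, 0 < x → n x ≤ sSup S := fun x hx => le_csSup Sb ⟨x, hx, rfl⟩
  have near : ∀ ε > 0, ∃ δ > 0, ∀ x, 0 < x → x < δ → sSup S - ε < n x := by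
    intro ε hε
    obtain ⟨_, ⟨δ, hδ, rfl⟩, hl⟩ := exists_lt_of_lt_csSup Sn (show sSup S - ε < sSup S by linarith)
    exact ⟨δ, hδ, fun x hx hxd => lt_of_lt_of_le hl (anti x δ hx hxd)⟩
  have hc : Cauchy (map L (𝓝[>] 0)) := by
    rw [Metric.cauchy_iff]
    refine ⟨inferInstance, fun ε hε => ?_⟩
    obtain ⟨δ, hδ, H⟩ := near (ε ^ 2 / 2) (by positivity)
    refine ⟨L '' Set.Ioo 0 δ, image_mem_map (Ioo_mem_nhdsGT hδ), ?_⟩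
    rintro _ ⟨x, hx, rfl⟩ _ ⟨y, hy, rfl⟩
    have e := hL x y hx.1 hy.1
    have e1 := le_sup x hx.1
    have e2 := le_sup y hy.1
    have e3 := H ((x + y) / 2) (by linarith [hx.1, hy.1]) (by linarith [hx.2, hy.2])
    rw [dist_eq_norm]
    refine lt_of_pow_lt_pow_left₀ 2 hε.le ?_
    simp only [hn] at *
    linarith
  obtain ⟨g, hg⟩ := CompleteSpace.complete hc
  refine ⟨g, hg, fun x hx => ?_⟩
  have ht : Tendsto (fun y => ‖L y‖) (𝓝[>] 0) (𝓝 ‖g‖) := (Tendsto.norm hg)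
  refine ge_of_tendsto ht ?_
  filter_upwards [Ioo_mem_nhdsGT hx] with y hy
  exact le_of_sq_le_sq (anti y x hy.1 hy.2) (norm_nonneg _)

theorem strip_shift (K : ℂ → ℂ) (a : ℝ)
    (hK : DifferentiableOn ℂ K {z | 0 < z.re ∧ z.re < a}) (M : ℝ≥0∞) (hM : M ≠ ⊤)
    (hb : ∀ u : ℝ, 0 < u → u < a → ∫⁻ ω : ℝ, ‖K (u + ω * I)‖ₑ ≤ M)
    {u v : ℝ} (hu : 0 < u) (huv : u ≤ v) (hv : v < a) :
    ∫ ω : ℝ, K (u + ω * I) = ∫ ω : ℝ, K (v + ω * I) := by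
  have line : ∀ t : ℝ, 0 < t → t < a → Continuous fun ω : ℝ => K (t + ω * I) := by
    intro t h0 h1
    refine hK.continuousOn.comp_continuous (by fun_prop) (fun ω => ?_)
    simp [h0, h1]
  have int : ∀ t : ℝ, 0 < t → t < a → Integrable fun ω : ℝ => K (t + ω * I) := by
    intro t h0 h1
    exact ⟨(line t h0 h1).aestronglyMeasurable, (hb t h0 h1).trans_lt hM.lt_top⟩
  have hu' := int u hu (huv.trans_lt hv)
  have hv' := int v (hu.trans_le huv) hv
  set h : ℝ → ℝ≥0∞ := fun R => ∫⁻ x in Set.Icc u v, ‖K (x + R * I)‖ₑ with hh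
  have meas : AEMeasurable (fun q : ℝ × ℝ => ‖K (q.2 + q.1 * I)‖ₑ)
      (volume.prod (volume.restrict (Set.Icc u v))) := by
    have : ContinuousOn (fun q : ℝ × ℝ => K (q.2 + q.1 * I)) (Set.univ ×ˢ Set.Icc u v) := by
      refine hK.continuousOn.comp (by fun_prop) ?_
      rintro ⟨x, y⟩ ⟨-, hy⟩
      simp only [Set.mem_ofPred_eq, add_re, ofReal_re, mul_re, I_re, mul_zero, ofReal_im, I_im,
        mul_one, sub_self, add_zero]
      exact ⟨hu.trans_le hy.1, hy.2.trans_lt hv⟩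
    have := this.aestronglyMeasurable (μ := volume.prod volume)
      (MeasurableSet.univ.prod measurableSet_Icc)
    rw [← Measure.prod_restrict, Measure.restrict_univ] at this
    exact this.enorm
  have hfin : ∫⁻ R, h R ≠ ⊤ := by
    rw [lintegral_lintegral_swap meas]
    have : ∫⁻ x in Set.Icc u v, ∫⁻ R : ℝ, ‖K (x + R * I)‖ₑ ≤ ∫⁻ x in Set.Icc u v, M :=
      setLIntegral_mono measurable_const
        (fun x hx => hb x (hu.trans_le hx.1) (hx.2.trans_lt hv))
    refine (this.trans_lt ?_).ne
    rw [setLIntegral_const]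
    exact ENNReal.mul_lt_top hM.lt_top (by simp)
  set D := (∫ ω : ℝ, K (v + ω * I)) - ∫ ω : ℝ, K (u + ω * I) with hD
  set Φ : ℝ → ℂ := fun R => (∫ ω in (-R)..R, K (v + ω * I)) - ∫ ω in (-R)..R, K (u + ω * I)
  have hΦ : Tendsto Φ atTop (𝓝 D) :=
    (intervalIntegral_tendsto_integral hv' tendsto_neg_atTop_atBot tendsto_id).sub
      (intervalIntegral_tendsto_integral hu' tendsto_neg_atTop_atBot tendsto_id)
  have hside : ∀ R : ℝ, ‖∫ x in u..v, K (x + R * I)‖ₑ ≤ h R := by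
    intro R
    rw [intervalIntegral.integral_of_le huv, ← integral_Icc_eq_integral_Ioc]
    exact enorm_integral_le_lintegral_enorm _
  have hbound : ∀ R : ℝ, ‖Φ R‖ₑ ≤ h (-R) + h R := by
    intro R
    have := integral_boundary_rect_eq_zero_of_differentiableOn K (u + (-R : ℝ) * I) (v + R * I)
      (hK.mono (by
        intro z hz
        rw [mem_reProdIm] at hz
        have := hz.1
        simp [Set.uIcc_of_le huv] at this
        exact ⟨hu.trans_le this.1, this.2.trans_lt hv⟩))
    simp only [add_re, ofReal_re, mul_re, I_re, mul_zero, ofReal_im, I_im, mul_one, sub_self,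
      add_zero, add_im, mul_im, zero_add, smul_eq_mul] at this
    have e : I * Φ R = (∫ x in u..v, K (x + R * I)) - ∫ x in u..v, K (x + (-R : ℝ) * I) := by
      simp only [Φ]
      linear_combination this
    have e2 : ‖Φ R‖ₑ = ‖I * Φ R‖ₑ := by
      rw [enorm_mul]; simp [enorm, nnnorm]
    rw [e2, e]
    refine (enorm_sub_le).trans ?_
    rw [add_comm]
    exact add_le_add (hside _) (hside _)
  have hfin2 : ∫⁻ R, (h (-R) + h R) ≠ ⊤ := by
    have hm : AEMeasurable h := meas.lintegral_prod_right'
    rw [lintegral_add_right' _ hm]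
    rw [lintegral_neg_eq_self h]
    exact ENNReal.add_ne_top.2 ⟨hfin, hfin⟩
  by_contra hne
  have hD0 : D ≠ 0 := fun h0 => hne (sub_eq_zero.1 h0).symm
  have hev : ∀ᶠ R in atTop, ‖D‖ / 2 < ‖Φ R‖ :=
    (hΦ.norm).eventually_const_lt (by have := norm_pos_iff.2 hD0; linarith)
  obtain ⟨R₀, hR₀⟩ := eventually_atTop.1 hev
  apply hfin2
  rw [eq_top_iff]
  calc (⊤ : ℝ≥0∞) = ∫⁻ _ in Set.Ici R₀, ENNReal.ofReal (‖D‖ / 2) := by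
        rw [setLIntegral_const, Real.volume_Ici, ENNReal.mul_top]
        simpa using hD0
    _ ≤ ∫⁻ R in Set.Ici R₀, (h (-R) + h R) := by
        refine setLIntegral_mono' measurableSet_Ici (fun R hR => ?_)
        refine le_trans ?_ (hbound R)
        rw [← ofReal_norm]
        exact ENNReal.ofReal_le_ofReal (hR₀ R hR).le
    _ ≤ _ := setLIntegral_le_lintegral _ _

theorem scalar_boundary (f : ℂ → ℂ) (hf : DifferentiableOn ℂ f {z | 0 < z.re})
    (hb : (⨆ ξ ∈ Set.Ioi (0 : ℝ), ∫⁻ ω : ℝ, ‖f (ξ + ω * I)‖ₑ ^ 2) < ⊤) :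
    ∃ g : ℝ → ℂ, MemLp g 2 ∧
      Tendsto (fun ξ : ℝ => eLpNorm (fun ω : ℝ => f (ξ + ω * I) - g ω) 2) (𝓝[>] 0) (𝓝 0) ∧
      ∀ ξ : ℝ, 0 < ξ → eLpNorm (fun ω : ℝ => f (ξ + ω * I)) 2 ≤ eLpNorm g 2 := by
  set M := ⨆ ξ ∈ Set.Ioi (0 : ℝ), ∫⁻ ω : ℝ, ‖f (ξ + ω * I)‖ₑ ^ 2 with hMdef
  have hM : ∀ ξ : ℝ, 0 < ξ → ∫⁻ ω : ℝ, ‖f (ξ + ω * I)‖ₑ ^ 2 ≤ M := fun ξ hξ =>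
    le_iSup₂ (f := fun (ξ : ℝ) (_ : ξ ∈ Set.Ioi (0 : ℝ)) => ∫⁻ ω : ℝ, ‖f (ξ + ω * I)‖ₑ ^ 2) ξ hξ
  have line : ∀ t : ℝ, 0 < t → Continuous fun ω : ℝ => f (t + ω * I) := by
    intro t h0
    refine hf.continuousOn.comp_continuous (by fun_prop) (fun ω => ?_)
    simp [h0]
  have nrm : ∀ g : ℝ → ℂ, eLpNorm g 2 = (∫⁻ ω, ‖g ω‖ₑ ^ 2) ^ (1 / 2 : ℝ) := by
    intro g
    rw [eLpNorm_eq_lintegral_rpow_enorm_toReal (by simp) (by simp)]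
    simp
  have mem : ∀ t : ℝ, 0 < t → MemLp (fun ω : ℝ => f (t + ω * I)) 2 := by
    intro t h0
    refine ⟨(line t h0).aestronglyMeasurable, ?_⟩
    rw [nrm]
    exact ENNReal.rpow_lt_top_of_nonneg (by norm_num) ((hM t h0).trans_lt hb).ne
  set L : ℝ → Lp ℂ 2 (volume : Measure ℝ) :=
    fun t => if h : 0 < t then (mem t h).toLp _ else 0 with hLdef
  have hLpos : ∀ t (h : 0 < t), L t = (mem t h).toLp _ := fun t h => by simp [hLdef, h]
  have hinner : ∀ x y, 0 < x → 0 < y →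
      inner ℂ (L x) (L y) = ∫ ω : ℝ, conj (f (x + ω * I)) * f (y + ω * I) := by
    intro x y hx hy
    rw [L2.inner_def, hLpos x hx, hLpos y hy]
    refine integral_congr_ae ?_
    filter_upwards [(mem x hx).coeFn_toLp, (mem y hy).coeFn_toLp] with ω h1 h2
    rw [h1, h2, RCLike.inner_apply, mul_comm]
  have hshift : ∀ x y, 0 < x → x ≤ y →
      inner ℂ (L y) (L x) = inner ℂ (L ((x + y) / 2)) (L ((x + y) / 2)) := by
    intro x y hx hxy
    have hy : 0 < y := hx.trans_le hxy
    rw [hinner y x hy hx, hinner _ _ (by linarith) (by linarith)]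
    have := strip_shift (fun z => conj (f (x + y - conj z)) * f z) (x + y) ?_ M hb.ne ?_
      (u := x) (v := (x + y) / 2) hx (by linarith) (by linarith)
    · have e1 : ∀ ω : ℝ, (x : ℂ) + y - conj ((x : ℂ) + ω * I) = y + ω * I := by
        intro ω; simp
      have e2 : ∀ ω : ℝ, (x : ℂ) + y - conj ((((x + y) / 2 : ℝ) : ℂ) + ω * I) =
          ((x + y) / 2 : ℝ) + ω * I := by
        intro ω
        rw [map_add, map_mul, conj_ofReal, conj_ofReal, conj_I]; push_cast; ring
      simpa only [e1, e2] using this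
    · intro z hz
      have h1 : DifferentiableAt ℂ f z :=
        (hf z hz.1).differentiableAt ((isOpen_lt continuous_const continuous_re).mem_nhds hz.1)
      have hz2 : 0 < ((x : ℂ) + y - conj z).re := by simpa using hz.2
      have h2 : DifferentiableAt ℂ f (x + y - conj z) :=
        (hf _ hz2).differentiableAt ((isOpen_lt continuous_const continuous_re).mem_nhds hz2)
      have h3 : DifferentiableAt ℂ (fun w => f (x + y - w)) (conj z) :=
        DifferentiableAt.comp (conj z) h2 (by fun_prop)
      have h4 := h3.conj_conj
      simp only [conj_conj] at h4
      exact (h4.mul h1).differentiableWithinAt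
    · intro u hu0 hu1
      have e : ∀ ω : ℝ, (x : ℂ) + y - conj ((u : ℂ) + ω * I) = ((x + y - u : ℝ) : ℂ) + ω * I := by
        intro ω; simp; ring
      simp only [e]
      have h0 : 0 < x + y - u := by linarith
      calc ∫⁻ ω : ℝ, ‖conj (f ((x + y - u : ℝ) + ω * I)) * f (u + ω * I)‖ₑ
          = ∫⁻ ω : ℝ, ‖f ((x + y - u : ℝ) + ω * I)‖ₑ * ‖f (u + ω * I)‖ₑ := by
            refine lintegral_congr (fun ω => ?_)
            rw [enorm_mul]
            congr 1
            rw [← ofReal_norm, ← ofReal_norm, RCLike.norm_conj]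
        _ ≤ (∫⁻ ω : ℝ, ‖f ((x + y - u : ℝ) + ω * I)‖ₑ ^ (2 : ℝ)) ^ (1 / 2 : ℝ) *
            (∫⁻ ω : ℝ, ‖f (u + ω * I)‖ₑ ^ (2 : ℝ)) ^ (1 / 2 : ℝ) :=
            ENNReal.lintegral_mul_le_Lp_mul_Lq _ Real.HolderConjugate.two_two
              (line _ h0).enorm.aemeasurable (line _ hu0).enorm.aemeasurable
        _ ≤ M ^ (1 / 2 : ℝ) * M ^ (1 / 2 : ℝ) := by
            simp only [ENNReal.rpow_ofNat]
            gcongr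
            · exact hM _ h0
            · exact hM _ hu0
        _ = M := by
            rw [← ENNReal.rpow_add_of_nonneg _ _ (by norm_num) (by norm_num)]
            norm_num
  have hpar : ∀ x y, 0 < x → x ≤ y →
      ‖L x - L y‖ ^ 2 = ‖L x‖ ^ 2 + ‖L y‖ ^ 2 - 2 * ‖L ((x + y) / 2)‖ ^ 2 := by
    intro x y hx hxy
    have h1 := norm_sub_sq (𝕜 := ℂ) (L y) (L x)
    rw [hshift x y hx hxy, inner_self_eq_norm_sq] at h1
    rw [norm_sub_rev]
    linarith
  obtain ⟨g, hg, hle⟩ := hilbert_limit L (M.toReal) (by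
      intro x hx
      have h1 : ‖L x‖ₑ = (∫⁻ ω : ℝ, ‖f (x + ω * I)‖ₑ ^ 2) ^ (1 / 2 : ℝ) := by
        rw [hLpos x hx, Lp.enorm_toLp, nrm]
      have h2 : ‖L x‖ₑ ^ 2 ≤ M := by
        rw [h1, ← ENNReal.rpow_natCast, ← ENNReal.rpow_mul]
        simpa using hM x hx
      rw [← toReal_enorm, ← ENNReal.toReal_pow]
      exact ENNReal.toReal_mono hb.ne h2) (by
      intro x y hx hy
      rcases le_total x y with h | h
      · exact hpar x y hx h
      · rw [norm_sub_rev, hpar y x hy h, add_comm y x]; ring)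
  refine ⟨g, Lp.memLp g, ?_, ?_⟩
  · have h1 : Tendsto (fun ξ => ‖L ξ - g‖ₑ) (𝓝[>] 0) (𝓝 0) := by
      have := (tendsto_iff_edist_tendsto_0).1 hg
      simpa only [edist_eq_enorm_sub] using this
    refine h1.congr' ?_
    filter_upwards [self_mem_nhdsWithin] with ξ hξ
    rw [hLpos ξ hξ, Lp.enorm_def]
    refine eLpNorm_congr_ae ?_
    filter_upwards [Lp.coeFn_sub ((mem ξ hξ).toLp _) g, (mem ξ hξ).coeFn_toLp] with ω h1 h2
    rw [h1, Pi.sub_apply, h2]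
  · intro ξ hξ
    have h1 := hle ξ hξ
    have h2 : ‖L ξ‖ₑ ≤ ‖g‖ₑ := by
      rw [← ofReal_norm, ← ofReal_norm]; exact ENNReal.ofReal_le_ofReal h1
    rwa [hLpos ξ hξ, Lp.enorm_toLp, Lp.enorm_def] at h2

/-- `f` is the boundary function `ω ↦ F(iω)` of a function on the open right half-plane: the `L²`
limit of `ω ↦ F(ξ + iω)` as `ξ → 0+`. -/
def IsBoundaryValue (F : ℂ → ℂ) (f : ℝ → ℂ) : Prop :=
  MemLp f 2 volume ∧
    Tendsto (fun ξ : ℝ => eLpNorm (fun ω : ℝ => F (ξ + ω * I) - f ω) 2 volume) (𝓝[>] 0) (𝓝 0)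

theorem IsBoundaryValue.unique {F : ℂ → ℂ}
    (hF : DifferentiableOn ℂ F {s | 0 < s.re}) {f g : ℝ → ℂ}
    (hf : IsBoundaryValue F f) (hg : IsBoundaryValue F g) : f =ᵐ[volume] g := by
  have h0 : eLpNorm (f - g) 2 volume ≤ 0 := by
    have ht := hf.2.add hg.2
    rw [add_zero] at ht
    refine ge_of_tendsto ht ?_
    filter_upwards [self_mem_nhdsWithin] with ξ hξ
    have hc : Continuous fun ω : ℝ => F (ξ + ω * I) :=
      hF.continuousOn.comp_continuous (by fun_prop) (fun ω => by simpa using hξ)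
    have e : f - g = (fun ω : ℝ => F (ξ + ω * I) - g ω) - fun ω : ℝ => F (ξ + ω * I) - f ω := by
      ext ω; simp
    rw [e, add_comm]
    exact eLpNorm_sub_le (hc.aestronglyMeasurable.sub hg.1.1)
      (hc.aestronglyMeasurable.sub hf.1.1) (by norm_num)
  have h1 := (eLpNorm_eq_zero_iff (hf.1.1.sub hg.1.1) (by norm_num)).1 (le_antisymm h0 bot_le)
  filter_upwards [h1] with ω hω
  exact sub_eq_zero.1 hω

theorem IsBoundaryValue.add {F G : ℂ → ℂ}
    (hF : DifferentiableOn ℂ F {s | 0 < s.re}) (hG : DifferentiableOn ℂ G {s | 0 < s.re})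
    {f g : ℝ → ℂ}
    (hf : IsBoundaryValue F f) (hg : IsBoundaryValue G g) : IsBoundaryValue (F + G) (f + g) := by
  refine ⟨hf.1.add hg.1, ?_⟩
  have ht := hf.2.add hg.2
  rw [add_zero] at ht
  refine tendsto_of_tendsto_of_tendsto_of_le_of_le' tendsto_const_nhds ht
    (Eventually.of_forall fun _ => bot_le) ?_
  filter_upwards [self_mem_nhdsWithin] with ξ hξ
  have hc : ∀ K : ℂ → ℂ, DifferentiableOn ℂ K {s | 0 < s.re} →
      Continuous fun ω : ℝ => K (ξ + ω * I) := fun K hK =>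
    hK.continuousOn.comp_continuous (by fun_prop) (fun ω => by simpa using hξ)
  have e : (fun ω : ℝ => (F + G) (ξ + ω * I) - (f + g) ω) =
      (fun ω : ℝ => F (ξ + ω * I) - f ω) + fun ω : ℝ => G (ξ + ω * I) - g ω := by
    ext ω; simp only [Pi.add_apply]; abel
  rw [e]
  exact eLpNorm_add_le ((hc F hF).aestronglyMeasurable.sub hf.1.1)
      ((hc G hG).aestronglyMeasurable.sub hg.1.1) (by norm_num)

theorem IsBoundaryValue.const_mul {F : ℂ → ℂ} {f : ℝ → ℂ}
    (hf : IsBoundaryValue F f) (c : ℂ) :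
    IsBoundaryValue (fun s => c * F s) (fun ω => c * f ω) := by
  refine ⟨hf.1.const_mul c, ?_⟩
  have ht : Tendsto (fun ξ : ℝ => ‖c‖ₑ *
      eLpNorm (fun ω : ℝ => F (ξ + ω * I) - f ω) 2 volume) (𝓝[>] 0) (𝓝 0) := by
    simpa using ENNReal.Tendsto.const_mul (a := ‖c‖ₑ) hf.2 (Or.inr (by simp))
  refine ht.congr fun ξ => ?_
  rw [← eLpNorm_const_smul]
  congr 1
  ext ω
  simp [mul_sub]

/-- The Hardy space of `p × m` matrix functions, analytic on the open right half-plane, with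
`sup_{ξ > 0} ∫ ‖F(ξ + iω)‖_F² dω < ∞` (the double sum is the squared Frobenius norm). A function on
the open right half-plane is represented by its extension by `0` to `ℂ`. -/
def hardySubmodule (p m : ℕ) : Submodule ℂ (ℂ → Matrix (Fin p) (Fin m) ℂ) where
  carrier := {F | (∀ i j, DifferentiableOn ℂ (fun s => F s i j) {s | 0 < s.re}) ∧
    (⨆ ξ ∈ Set.Ioi (0 : ℝ), ∫⁻ ω : ℝ, ∑ i, ∑ j, ‖F (ξ + ω * I) i j‖ₑ ^ 2) < ⊤ ∧
    ∀ s : ℂ, s.re ≤ 0 → F s = 0}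
  zero_mem' := by
    refine ⟨fun _ _ => differentiableOn_const _, ?_, fun _ _ => rfl⟩
    simp
  add_mem' := by
    rintro F G ⟨hF1, hF2, hF3⟩ ⟨hG1, hG2, hG3⟩
    refine ⟨fun i j => (hF1 i j).add (hG1 i j), ?_, fun s hs => by simp [hF3 s hs, hG3 s hs]⟩
    refine lt_of_le_of_lt ?_ (ENNReal.mul_lt_top (ENNReal.ofNat_lt_top (n := 2))
      (ENNReal.add_lt_top.2 ⟨hF2, hG2⟩))
    refine iSup₂_le fun ξ hξ => ?_
    have hc : ∀ i j, Continuous fun ω : ℝ => F (ξ + ω * I) i j := fun i j =>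
      (hF1 i j).continuousOn.comp_continuous (by fun_prop) (fun ω => by simpa using hξ)
    calc ∫⁻ ω : ℝ, ∑ i, ∑ j, ‖(F + G) (ξ + ω * I) i j‖ₑ ^ 2
        ≤ ∫⁻ ω : ℝ, 2 * ((∑ i, ∑ j, ‖F (ξ + ω * I) i j‖ₑ ^ 2) +
            ∑ i, ∑ j, ‖G (ξ + ω * I) i j‖ₑ ^ 2) := by
          refine lintegral_mono fun ω => ?_
          simp only [← Finset.sum_add_distrib, Finset.mul_sum]
          refine Finset.sum_le_sum fun i _ => Finset.sum_le_sum fun j _ => ?_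
          refine (pow_le_pow_left₀ (by simp) (enorm_add_le _ _) 2).trans ?_
          have := ENNReal.rpow_add_le_mul_rpow_add_rpow ‖F (ξ + ω * I) i j‖ₑ
            ‖G (ξ + ω * I) i j‖ₑ (p := 2) (by norm_num)
          norm_num at this
          exact this
      _ = 2 * ((∫⁻ ω : ℝ, ∑ i, ∑ j, ‖F (ξ + ω * I) i j‖ₑ ^ 2) +
            ∫⁻ ω : ℝ, ∑ i, ∑ j, ‖G (ξ + ω * I) i j‖ₑ ^ 2) := by
          rw [lintegral_const_mul' _ _ (by simp), lintegral_add_left']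
          exact Finset.aemeasurable_fun_sum _ fun i _ => Finset.aemeasurable_fun_sum _ fun j _ =>
            ((hc i j).enorm.aemeasurable.pow_const 2)
      _ ≤ _ := by
          gcongr
          · exact le_iSup₂ (f := fun (ξ : ℝ) (_ : ξ ∈ Set.Ioi (0 : ℝ)) =>
              ∫⁻ ω : ℝ, ∑ i, ∑ j, ‖F (ξ + ω * I) i j‖ₑ ^ 2) ξ hξ
          · exact le_iSup₂ (f := fun (ξ : ℝ) (_ : ξ ∈ Set.Ioi (0 : ℝ)) =>
              ∫⁻ ω : ℝ, ∑ i, ∑ j, ‖G (ξ + ω * I) i j‖ₑ ^ 2) ξ hξ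
  smul_mem' := by
    rintro c F ⟨hF1, hF2, hF3⟩
    refine ⟨fun i j => (hF1 i j).const_mul c, ?_, fun s hs => by simp [hF3 s hs]⟩
    have : ∀ ξ : ℝ, ∫⁻ ω : ℝ, ∑ i, ∑ j, ‖(c • F) (ξ + ω * I) i j‖ₑ ^ 2 =
        ‖c‖ₑ ^ 2 * ∫⁻ ω : ℝ, ∑ i, ∑ j, ‖F (ξ + ω * I) i j‖ₑ ^ 2 := by
      intro ξ
      rw [← lintegral_const_mul' _ _ (by simp)]
      refine lintegral_congr fun ω => ?_
      simp only [Finset.mul_sum]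
      refine Finset.sum_congr rfl fun i _ => Finset.sum_congr rfl fun j _ => ?_
      rw [Pi.smul_apply, Matrix.smul_apply, enorm_smul, mul_pow]
    simp only [this, ← ENNReal.mul_iSup]
    exact ENNReal.mul_lt_top (by simp) hF2

/-- The Hardy space as a type, so that its only norm is the one defined below. -/
def Hardy (p m : ℕ) : Type := hardySubmodule p m

namespace Hardy

variable {p m : ℕ}

noncomputable instance : AddCommGroup (Hardy p m) :=
  inferInstanceAs (AddCommGroup (hardySubmodule p m))

noncomputable instance : Module ℂ (Hardy p m) := inferInstanceAs (Module ℂ (hardySubmodule p m))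

instance : CoeFun (Hardy p m) (fun _ => ℂ → Matrix (Fin p) (Fin m) ℂ) := ⟨fun F => F.1⟩

theorem entry_boundary (F : Hardy p m) (i : Fin p) (j : Fin m) :
    ∃ g : ℝ → ℂ, IsBoundaryValue (fun s => F s i j) g ∧
      ∀ ξ : ℝ, 0 < ξ → eLpNorm (fun ω : ℝ => F (ξ + ω * I) i j) 2 ≤ eLpNorm g 2 := by
  obtain ⟨h1, h2, -⟩ := F.2
  obtain ⟨g, hg1, hg2, hg3⟩ := scalar_boundary (fun s => F s i j) (h1 i j)
    (lt_of_le_of_lt (iSup₂_mono fun ξ _ => lintegral_mono fun ω => by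
      refine le_trans ?_ (Finset.single_le_sum
        (f := fun i => ∑ j, ‖F.1 (ξ + ω * I) i j‖ₑ ^ 2) (fun _ _ => by simp) (Finset.mem_univ i))
      exact Finset.single_le_sum (f := fun j => ‖F.1 (ξ + ω * I) i j‖ₑ ^ 2)
        (fun _ _ => by simp) (Finset.mem_univ j)) h2)
  exact ⟨g, ⟨hg1, hg2⟩, hg3⟩

theorem exists_boundary (F : Hardy p m) :
    ∃ f : ℝ → Matrix (Fin p) (Fin m) ℂ,
      ∀ i j, IsBoundaryValue (fun s => F s i j) (fun ω => f ω i j) := by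
  choose g hg _ using entry_boundary F
  exact ⟨fun ω i j => g i j ω, hg⟩

/-- The extension `ω ↦ F(iω)` of `F` to the imaginary axis (unique up to null sets). -/
noncomputable def boundary (F : Hardy p m) : ℝ → Matrix (Fin p) (Fin m) ℂ :=
  (exists_boundary F).choose

theorem isBoundaryValue (F : Hardy p m) (i : Fin p) (j : Fin m) :
    IsBoundaryValue (fun s => F s i j) (fun ω => F.boundary ω i j) :=
  (exists_boundary F).choose_spec i j

theorem boundary_add (F G : Hardy p m) :
    ∀ᵐ ω : ℝ, (F + G).boundary ω = F.boundary ω + G.boundary ω := by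
  have h : ∀ i j, ∀ᵐ ω : ℝ, (F + G).boundary ω i j = F.boundary ω i j + G.boundary ω i j :=
    fun i j => ((F + G).isBoundaryValue i j).unique ((F + G).2.1 i j)
      ((F.isBoundaryValue i j).add (F.2.1 i j) (G.2.1 i j) (G.isBoundaryValue i j))
  simp only [← ae_all_iff] at h
  filter_upwards [h] with ω hω
  ext i j
  exact hω i j

theorem boundary_smul (c : ℂ) (F : Hardy p m) :
    ∀ᵐ ω : ℝ, (c • F).boundary ω = c • F.boundary ω := by
  have h : ∀ i j, ∀ᵐ ω : ℝ, (c • F).boundary ω i j = c * F.boundary ω i j :=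
    fun i j => ((c • F).isBoundaryValue i j).unique ((c • F).2.1 i j)
      ((F.isBoundaryValue i j).const_mul c)
  simp only [← ae_all_iff] at h
  filter_upwards [h] with ω hω
  ext i j
  exact hω i j

theorem integrable_trace (F G : Hardy p m) :
    Integrable fun ω => Matrix.trace ((F.boundary ω)ᴴ * G.boundary ω) := by
  simp only [Matrix.trace, Matrix.diag, Matrix.mul_apply, Matrix.conjTranspose_apply]
  refine integrable_finsetSum _ fun j _ => integrable_finsetSum _ fun i _ => ?_
  exact MemLp.integrable_mul (p := 2) (q := 2) (F.isBoundaryValue i j).1.star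
    (G.isBoundaryValue i j).1

theorem trace_self (A : Matrix (Fin p) (Fin m) ℂ) :
    Matrix.trace (Aᴴ * A) = ((∑ j, ∑ i, ‖A i j‖ ^ 2 : ℝ) : ℂ) := by
  simp only [Matrix.trace, Matrix.diag, Matrix.mul_apply, Matrix.conjTranspose_apply]
  push_cast
  refine Finset.sum_congr rfl fun j _ => Finset.sum_congr rfl fun i _ => ?_
  exact conj_mul' _

/-- `⟨F, G⟩ = (1 / 2π) ∫ tr (F(iω)* G(iω)) dω`, through the boundary values. -/
noncomputable def innerProd (F G : Hardy p m) : ℂ :=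
  1 / (2 * Real.pi) * ∫ ω : ℝ, Matrix.trace ((F.boundary ω)ᴴ * G.boundary ω)

theorem innerProd_conj_symm (F G : Hardy p m) : conj (innerProd G F) = innerProd F G := by
  unfold innerProd
  rw [map_mul, ← integral_conj]
  have h1 : conj (1 / (2 * Real.pi) : ℂ) = 1 / (2 * Real.pi) := by
    rw [map_div₀, map_mul, conj_ofReal, map_one, map_ofNat]
  have h2 : ∀ ω : ℝ, conj (Matrix.trace ((G.boundary ω)ᴴ * F.boundary ω)) =
      Matrix.trace ((F.boundary ω)ᴴ * G.boundary ω) := by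
    intro ω
    have := Matrix.trace_conjTranspose ((G.boundary ω)ᴴ * F.boundary ω)
    rw [Matrix.conjTranspose_mul, Matrix.conjTranspose_conjTranspose] at this
    exact this.symm
  rw [h1, integral_congr_ae (Eventually.of_forall h2)]

theorem innerProd_self (F : Hardy p m) : innerProd F F =
    ((1 / (2 * Real.pi) * ∫ ω : ℝ, ∑ j, ∑ i, ‖F.boundary ω i j‖ ^ 2 : ℝ) : ℂ) := by
  unfold innerProd
  have h : ∫ ω : ℝ, Matrix.trace ((F.boundary ω)ᴴ * F.boundary ω) =
      ((∫ ω : ℝ, ∑ j, ∑ i, ‖F.boundary ω i j‖ ^ 2 : ℝ) : ℂ) :=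
    (integral_congr_ae (Eventually.of_forall fun ω => trace_self (F.boundary ω))).trans
      integral_ofReal
  rw [h]
  push_cast
  rfl

theorem innerProd_add_left (F G K : Hardy p m) :
    innerProd (F + G) K = innerProd F K + innerProd G K := by
  unfold innerProd
  rw [← mul_add, ← integral_add (integrable_trace F K) (integrable_trace G K)]
  refine congrArg _ (integral_congr_ae ?_)
  filter_upwards [boundary_add F G] with ω hω
  rw [hω, Matrix.conjTranspose_add, Matrix.add_mul, Matrix.trace_add]

theorem innerProd_smul_left (F G : Hardy p m) (c : ℂ) :
    innerProd (c • F) G = conj c * innerProd F G := by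
  unfold innerProd
  rw [mul_left_comm, ← integral_const_mul (conj c)]
  refine congrArg (fun z : ℂ => 1 / (2 * Real.pi) * z) (integral_congr_ae ?_)
  filter_upwards [boundary_smul c F] with ω hω
  rw [hω, Matrix.conjTranspose_smul, Matrix.smul_mul, Matrix.trace_smul]
  rfl

theorem innerProd_definite (F : Hardy p m) (hF : innerProd F F = 0) : F = 0 := by
  rw [innerProd_self, ofReal_eq_zero] at hF
  have h0 := (mul_eq_zero.1 hF).resolve_left (by positivity)
  have hi' : Integrable fun ω : ℝ => ∑ j, ∑ i, ‖F.boundary ω i j‖ ^ 2 := by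
    have h1 := (integrable_trace F F).re
    refine h1.congr (Eventually.of_forall fun ω => ?_)
    change (Matrix.trace ((F.boundary ω)ᴴ * F.boundary ω)).re = _
    rw [trace_self, ofReal_re]
  rw [integral_eq_zero_iff_of_nonneg (fun ω => by positivity) hi'] at h0
  have hz : ∀ ξ : ℝ, 0 < ξ → ∀ i j, (fun ω : ℝ => F (ξ + ω * I) i j) = 0 := by
    intro ξ hξ i j
    obtain ⟨g, hg, hle⟩ := entry_boundary F i j
    have hF' : DifferentiableOn ℂ (fun s => F s i j) {s | 0 < s.re} :=
      F.2.1 i j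
    have hu := hg.unique hF' (F.isBoundaryValue i j)
    have hg0 : g =ᵐ[volume] 0 := by
      filter_upwards [hu, h0] with ω h1 h2
      rw [h1]
      have h3 := (Finset.sum_eq_zero_iff_of_nonneg (fun j _ => by positivity)).1 h2 j
        (Finset.mem_univ j)
      have h4 := (Finset.sum_eq_zero_iff_of_nonneg (fun i _ => by positivity)).1 h3 i
        (Finset.mem_univ i)
      simpa using h4
    have h5 := hle ξ hξ
    rw [eLpNorm_congr_ae hg0, eLpNorm_zero] at h5
    have hc : Continuous fun ω : ℝ => F (ξ + ω * I) i j :=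
      hF'.continuousOn.comp_continuous (by fun_prop) (fun ω => by simpa using hξ)
    have h6 := (eLpNorm_eq_zero_iff hc.aestronglyMeasurable (by norm_num)).1
      (le_antisymm h5 bot_le)
    exact (hc.ae_eq_iff_eq volume continuous_zero).1 h6
  apply Subtype.ext
  funext s
  rcases le_or_gt s.re 0 with hs | hs
  · exact F.2.2.2 s hs
  · ext i j
    have := congrFun (hz s.re hs i j) s.im
    rw [re_add_im] at this
    exact this

/-- The inner product axioms for `innerProd`. -/
@[reducible]
noncomputable def core (p m : ℕ) : InnerProductSpace.Core ℂ (Hardy p m) where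
  inner := innerProd
  conj_inner_symm := innerProd_conj_symm
  re_inner_nonneg F := by
    have h : (0 : ℝ) ≤ ∫ ω : ℝ, ∑ j, ∑ i, ‖F.boundary ω i j‖ ^ 2 :=
      integral_nonneg fun ω => by positivity
    rw [innerProd_self]
    change 0 ≤ (((_ : ℝ) : ℂ)).re
    rw [ofReal_re]
    exact mul_nonneg (by positivity) h
  add_left := innerProd_add_left
  smul_left := innerProd_smul_left
  definite := innerProd_definite

noncomputable instance : NormedAddCommGroup (Hardy p m) := (core p m).toNormedAddCommGroup

noncomputable instance : InnerProductSpace ℂ (Hardy p m) :=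
  InnerProductSpace.ofCore (core p m).toCore

theorem inner_def (F G : Hardy p m) : inner ℂ F G =
    1 / (2 * Real.pi) * ∫ ω : ℝ, Matrix.trace ((F.boundary ω)ᴴ * G.boundary ω) := rfl

/-- The derivative `F'(s)`, entry by entry. -/
noncomputable def derivative (F : Hardy p m) (s : ℂ) : Matrix (Fin p) (Fin m) ℂ :=
  Matrix.of fun i j => deriv (fun z => F z i j) s

end Hardy

/-- The transfer function `C (sI - A)⁻¹ B` of a state-space realization of order `r`. -/
noncomputable def transferFunction {r m p : ℕ} (A : Matrix (Fin r) (Fin r) ℂ)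
    (B : Matrix (Fin r) (Fin m) ℂ) (C : Matrix (Fin p) (Fin r) ℂ) (s : ℂ) :
    Matrix (Fin p) (Fin m) ℂ :=
  C * (s • (1 : Matrix (Fin r) (Fin r) ℂ) - A)⁻¹ * B

/-- All eigenvalues lie in the open left half-plane. -/
def IsHurwitz {r : ℕ} (A : Matrix (Fin r) (Fin r) ℂ) : Prop :=
  ∀ z ∈ spectrum ℂ A, z.re < 0

/-- No realization of the same rational function has smaller order. Two realizations give the same
rational function when their transfer functions agree wherever both resolvents exist. -/
def IsMinimalRealization {r m p : ℕ} (A : Matrix (Fin r) (Fin r) ℂ)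
    (B : Matrix (Fin r) (Fin m) ℂ) (C : Matrix (Fin p) (Fin r) ℂ) : Prop :=
  ∀ (r' : ℕ) (A' : Matrix (Fin r') (Fin r') ℂ) (B' : Matrix (Fin r') (Fin m) ℂ)
    (C' : Matrix (Fin p) (Fin r') ℂ),
    (∀ s : ℂ, s ∉ spectrum ℂ A → s ∉ spectrum ℂ A' →
      transferFunction A B C s = transferFunction A' B' C' s) → r ≤ r'

/-- The set of stable rational `p × m` transfer functions of McMillan degree `r`, as a subset of
the Hardy space. -/
def stableRational (r m p : ℕ) : Set (Hardy p m) :=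
  {F | ∃ (A : Matrix (Fin r) (Fin r) ℂ) (B : Matrix (Fin r) (Fin m) ℂ)
      (C : Matrix (Fin p) (Fin r) ℂ), IsHurwitz A ∧ IsMinimalRealization A B C ∧
      ∀ s : ℂ, 0 < s.re → F s = transferFunction A B C s}

/-- The tangent space at `x` of an embedded submanifold `S` of a normed space: the velocities at
time `0` of the smooth curves in `S` through `x`. -/
def tangentVectors {E : Type*} [NormedAddCommGroup E] [NormedSpace ℝ E] (S : Set E) (x : E) :
    Set E :=
  {v | ∃ (c : ℝ → E) (ε : ℝ), 0 < ε ∧ ContDiffOn ℝ ((⊤ : ℕ∞) : WithTop ℕ∞) c (Set.Ioo (-ε) ε) ∧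
      (∀ t ∈ Set.Ioo (-ε) ε, c t ∈ S) ∧ c 0 = x ∧ deriv c 0 = v}

/-- The normal space at `x`: the orthogonal complement of the tangent space. -/
noncomputable def normalSpace {E : Type*} [NormedAddCommGroup E] [InnerProductSpace ℂ E] (S : Set E) (x : E) :
    Submodule ℂ E :=
  (Submodule.span ℂ (tangentVectors S x))ᗮ

/-- `G` is an orthogonal projection of `H` onto `S` along the normal space of `S` at `x`. -/
def IsProjectionAlongNormal {E : Type*} [NormedAddCommGroup E] [InnerProductSpace ℂ E]
    (S : Set E) (x H G : E) : Prop :=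
  G ∈ S ∧ H - G ∈ normalSpace S x

/-- `F(s) = ∑ i, c i (b i)* / (s - lam i)`, an identity of rational functions. -/
def IsPoleResidueForm {r m p : ℕ} (lam : Fin r → ℂ) (b : Fin r → Fin m → ℂ)
    (c : Fin r → Fin p → ℂ) (F : Hardy p m) : Prop :=
  ∀ s : ℂ, 0 < s.re → (∀ i, s ≠ lam i) →
    F s = ∑ i, (s - lam i)⁻¹ • Matrix.vecMulVec (c i) (star (b i))

/-- One step of the iterative rational Krylov algorithm for `H`: the current iterate `Hk` has the
pole-residue form with data `lam, b, c`, and the next iterate `Hk'` is a bitangential Hermite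
interpolant of `H` at the reflected poles `-conj (lam i)` in the directions `b i`, `c i`. -/
def IsIRKAStep {r m p : ℕ} (lam : Fin r → ℂ) (b : Fin r → Fin m → ℂ) (c : Fin r → Fin p → ℂ)
    (H Hk Hk' : Hardy p m) : Prop :=
  IsPoleResidueForm lam b c Hk ∧
  ∀ i,
    H (-conj (lam i)) *ᵥ b i = Hk' (-conj (lam i)) *ᵥ b i ∧
    star (c i) ᵥ* H (-conj (lam i)) = star (c i) ᵥ* Hk' (-conj (lam i)) ∧
    star (c i) ⬝ᵥ (H.derivative (-conj (lam i)) *ᵥ b i) =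
      star (c i) ⬝ᵥ (Hk'.derivative (-conj (lam i)) *ᵥ b i)

/-! ### Cauchy's formula for scalar Hardy functions on the right half-plane -/

/-! Two facts carry the proof: poles are reproducing kernels of the Hardy space, and every velocity
at `Hk` is a combination of such poles whose matrix coefficients match the interpolation conditions.

Kernels. On the imaginary axis the conjugate of `1 / (s - a)` is the Cauchy kernel at the mirror
image `-conj a`. Hence pairing `M / (s - a)` with `F` gives `tr (Mᴴ F(-conj a))`, and pairing `M /
(s - a)²` with `F` gives `-tr (Mᴴ F'(-conj a))` (`inner_simplePole`, `inner_doublePole`). Behind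
this is Cauchy's formula for boundary values, `cauchy_formula_boundary`, which moves vertical lines
to infinity instead of closing contours by arcs.

Velocities. A curve in the set is smooth only as a curve of functions; no smooth, or even
continuous, choice of realizations `(A, B, C)` along it is given. The Loewner formula avoids the
lifting problem: a function with a realization of order `r` is `W Q(s)⁻¹ V`, where `W`, `Q(s)`, `V`
depend linearly on its values at `2r` fixed points, provided the Loewner matrix is invertible. Point
evaluations are inner products, hence continuous, so this formula can be differentiated along the
curve (`Loewner.velocity_eq`). At `Hk`, in the diagonal realization given by its poles and residues,
the velocity becomes a sum of terms `u b_i* / (s - lam i)`, `c_i w / (s - lam i)` and `c_i b_j* /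
((s - lam i)(s - lam j))` (`velocity_eq_of_poleResidue`).

Orthogonality. The right, left and derivative conditions annihilate the first kind, the second kind
and the third kind with `i = j`. For `i ≠ j` partial fractions split the third kind into one term of
each of the first two (`inner_velocity_eq_zero`).

Minimality of `Hk` makes all residues nonzero, which puts every pole in the left half-plane and lets
the sampling directions be chosen so that the Loewner matrix is invertible. -/

theorem inv_sq_add_sq_eq {d : ℝ} (hd : d ≠ 0) (η ω : ℝ) :
    (d ^ 2 + (ω - η) ^ 2)⁻¹ = (d ^ 2)⁻¹ * (1 + ((ω - η) / d) ^ 2)⁻¹ := by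
  rw [← mul_inv]
  congr 1
  field_simp

theorem integrable_vertical_inv_sq {d : ℝ} (hd : d ≠ 0) (η : ℝ) :
    Integrable fun ω : ℝ => (d ^ 2 + (ω - η) ^ 2)⁻¹ := by
  simp only [inv_sq_add_sq_eq hd]
  exact ((integrable_inv_one_add_sq.comp_div hd).comp_sub_right η).const_mul _

theorem integral_vertical_inv_sq {d : ℝ} (hd : 0 < d) (η : ℝ) :
    ∫ ω : ℝ, (d ^ 2 + (ω - η) ^ 2)⁻¹ = Real.pi / d := by
  simp only [inv_sq_add_sq_eq hd.ne']
  rw [integral_const_mul, integral_sub_right_eq_self (fun ω : ℝ => (1 + (ω / d) ^ 2)⁻¹),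
    Measure.integral_comp_div (fun ω : ℝ => (1 + ω ^ 2)⁻¹), integral_univ_inv_one_add_sq,
    abs_of_pos hd, smul_eq_mul]
  field_simp

theorem lintegral_vertical_inv_sq {d : ℝ} (hd : 0 < d) (η : ℝ) {C : ℝ} (hC : 0 ≤ C) :
    ∫⁻ ω : ℝ, ENNReal.ofReal (C * (d ^ 2 + (ω - η) ^ 2)⁻¹) = ENNReal.ofReal (C * (Real.pi / d)) := by
  rw [← integral_vertical_inv_sq hd η, ← integral_const_mul,
    ofReal_integral_eq_lintegral_ofReal ((integrable_vertical_inv_sq hd.ne' η).const_mul C)]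
  exact Eventually.of_forall fun ω => by positivity

theorem norm_vertical_sub_sq (x ω : ℝ) (a : ℂ) :
    ‖(x + ω * I : ℂ) - a‖ ^ 2 = (x - a.re) ^ 2 + (ω - a.im) ^ 2 := by
  rw [← normSq_eq_norm_sq, normSq_apply]
  simp
  ring

theorem vertical_sub_ne_zero {x : ℝ} {a : ℂ} (h : a.re < x) (ω : ℝ) : (x + ω * I : ℂ) - a ≠ 0 := by
  intro h0
  have := congrArg re h0
  simp at this
  linarith

theorem continuous_vertical_inv {x : ℝ} {a : ℂ} (h : a.re < x) :
    Continuous fun ω : ℝ => ((x + ω * I : ℂ) - a)⁻¹ :=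
  Continuous.inv₀ (by fun_prop) (vertical_sub_ne_zero h)

theorem lintegral_vertical_inv {x : ℝ} {a : ℂ} (h : a.re < x) :
    ∫⁻ ω : ℝ, ‖((x + ω * I : ℂ) - a)⁻¹‖ₑ ^ 2 = ENNReal.ofReal (Real.pi / (x - a.re)) := by
  have := lintegral_vertical_inv_sq (sub_pos.2 h) a.im zero_le_one
  rw [one_mul] at this
  rw [← this]
  refine lintegral_congr fun ω => ?_
  rw [← ofReal_norm, ← ENNReal.ofReal_pow (norm_nonneg _), norm_inv, inv_pow,
    norm_vertical_sub_sq, one_mul]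

theorem eLpNorm_two_lt_top_iff (g : ℝ → ℂ) : eLpNorm g 2 < ⊤ ↔ ∫⁻ ω, ‖g ω‖ₑ ^ 2 < ⊤ := by
  rw [eLpNorm_lt_top_iff_lintegral_rpow_enorm_lt_top (by simp) (by simp)]
  simp

theorem memLp_vertical_inv {x : ℝ} {a : ℂ} (h : a.re < x) :
    MemLp (fun ω : ℝ => ((x + ω * I : ℂ) - a)⁻¹) 2 := by
  refine ⟨(continuous_vertical_inv h).aestronglyMeasurable, (eLpNorm_two_lt_top_iff _).2 ?_⟩
  rw [lintegral_vertical_inv h]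
  exact ENNReal.ofReal_lt_top

theorem memLp_inv_sub_mul_I {σ : ℂ} (hσ : 0 < σ.re) :
    MemLp (fun ω : ℝ => (σ - ω * I)⁻¹) 2 := by
  have h := (memLp_vertical_inv (x := 0) (a := -conj σ) (by simpa using hσ)).star
  have e : (fun ω : ℝ => (σ - ω * I)⁻¹) =
      star fun ω : ℝ => (((0 : ℝ) + ω * I : ℂ) - -conj σ)⁻¹ := by
    funext ω
    rw [Pi.star_apply, RCLike.star_def, map_inv₀]
    congr 1
    simp
    ring
  rw [e]
  exact h

theorem continuous_vertical {f : ℂ → ℂ} (hf : DifferentiableOn ℂ f {s | 0 < s.re}) {x : ℝ}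
    (hx : 0 < x) : Continuous fun ω : ℝ => f (x + ω * I) :=
  hf.continuousOn.comp_continuous (by fun_prop) (fun ω => by simpa using hx)

/-- If a Hardy function vanishes at `σ`, its quotient by `z - σ` has integral zero over every
vertical line. -/
theorem integral_dslope_vertical_eq_zero {f : ℂ → ℂ} (hf : DifferentiableOn ℂ f {s | 0 < s.re})
    {M : ℝ} (hM : ∀ ξ : ℝ, 0 < ξ → ∫⁻ ω : ℝ, ‖f (ξ + ω * I)‖ₑ ^ 2 ≤ ENNReal.ofReal M)
    (hM0 : 0 ≤ M) {σ : ℂ} (hσ : 0 < σ.re) (h0 : f σ = 0) {u : ℝ} (hu : 0 < u) :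
    ∫ ω : ℝ, dslope f σ (u + ω * I) = 0 := by
  have hopen : IsOpen {s : ℂ | 0 < s.re} := isOpen_lt continuous_const continuous_re
  have hq : DifferentiableOn ℂ (dslope f σ) {s | 0 < s.re} :=
    (Complex.differentiableOn_dslope (hopen.mem_nhds hσ)).2 hf
  have hqne : ∀ z, z ≠ σ → ‖dslope f σ z‖ = ‖f z‖ * ‖z - σ‖⁻¹ := by
    intro z hz
    rw [dslope_of_ne _ hz, slope_def_field, h0, sub_zero, norm_div, div_eq_mul_inv]
  obtain ⟨δ, hδ, hδσ⟩ : ∃ δ > 0, δ < σ.re := ⟨σ.re / 2, by linarith, by linarith⟩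
  obtain ⟨Q, hQ⟩ := (isCompact_closedBall σ δ).exists_bound_of_continuousOn
    (hq.continuousOn.mono (by
      intro z hz
      have h1 := (abs_re_le_norm (z - σ)).trans (mem_closedBall_iff_norm.1 hz)
      rw [sub_re, abs_le] at h1
      show 0 < z.re
      linarith [h1.1]))
  have hQ0 : 0 ≤ Q := (norm_nonneg _).trans (hQ σ (by simp [hδ.le]))
  -- An `L¹` bound uniform in the line. Within distance `δ` of `σ` the quotient is at most `Q`;
  -- outside, `|f| / |z - σ| ≤ |f|² + |z - σ|⁻²` and `|z - σ|²` is at least half of `δ² + (ω - Im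
  -- σ)²`. The constant `2 + 2 δ² Q` covers both cases.
  have hbound : ∀ v : ℝ, 0 < v → ∫⁻ ω : ℝ, ‖dslope f σ (v + ω * I)‖ₑ ≤
      ENNReal.ofReal M + ENNReal.ofReal ((2 + 2 * δ ^ 2 * Q) * (Real.pi / δ)) := by
    intro v hv
    rw [← lintegral_vertical_inv_sq hδ σ.im (by positivity)]
    refine le_trans ?_ (add_le_add_left (hM v hv) _)
    rw [← lintegral_add_left' ((continuous_vertical hf hv).enorm.aemeasurable.pow_const 2)]
    refine lintegral_mono fun ω => ?_
    have hn := norm_vertical_sub_sq v ω σ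
    rw [← ofReal_norm, ← ofReal_norm, ← ENNReal.ofReal_pow (norm_nonneg _),
      ← ENNReal.ofReal_add (by positivity) (by positivity)]
    refine ENNReal.ofReal_le_ofReal ?_
    set z : ℂ := v + ω * I
    have hD : 0 < δ ^ 2 + (ω - σ.im) ^ 2 := by positivity
    rcases le_or_gt ‖z - σ‖ δ with hz | hz
    · have h1 := hQ z (mem_closedBall_iff_norm.2 hz)
      have h2 : ‖z - σ‖ ^ 2 ≤ δ ^ 2 := by gcongr
      have h3 : Q ≤ 2 * δ ^ 2 * Q * (δ ^ 2 + (ω - σ.im) ^ 2)⁻¹ := by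
        rw [← div_eq_mul_inv, le_div_iff₀ hD]
        nlinarith [sq_nonneg (v - σ.re)]
      have h4 : 0 ≤ 2 * (δ ^ 2 + (ω - σ.im) ^ 2)⁻¹ := by positivity
      nlinarith [sq_nonneg ‖f z‖]
    · have hz0 : 0 < ‖z - σ‖ := hδ.trans hz
      rw [hqne z (by rintro h; simp [h] at hz0)]
      have h2 : δ ^ 2 ≤ ‖z - σ‖ ^ 2 := by gcongr
      have h3 : (‖z - σ‖⁻¹) ^ 2 ≤ 2 * (δ ^ 2 + (ω - σ.im) ^ 2)⁻¹ := by
        rw [inv_pow, ← div_eq_mul_inv, inv_le_iff_one_le_mul₀ (by positivity),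
          div_mul_eq_mul_div, le_div_iff₀ hD]
        nlinarith [sq_nonneg (v - σ.re)]
      have h4 : 0 ≤ 2 * δ ^ 2 * Q * (δ ^ 2 + (ω - σ.im) ^ 2)⁻¹ := by positivity
      nlinarith [sq_nonneg (‖f z‖ - ‖z - σ‖⁻¹), sq_nonneg ‖f z‖, sq_nonneg ‖z - σ‖⁻¹]
  -- At distance `w²` to the right of `σ`, the weighted inequality `a b ≤ a² / w + w b²` makes both
  -- contributions of order `1 / w`: the second integral is `w · π / w²`.
  have hfar : ∀ w : ℝ, 0 < w → ‖∫ ω : ℝ, dslope f σ (((σ.re + w ^ 2 : ℝ) : ℂ) + ω * I)‖ₑ ≤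
      ENNReal.ofReal ((M + Real.pi) / w) := by
    intro w hw
    have hv : 0 < σ.re + w ^ 2 := by positivity
    have e : ENNReal.ofReal ((M + Real.pi) / w) =
        ENNReal.ofReal (1 / w) * ENNReal.ofReal M + ENNReal.ofReal (w * (Real.pi / w ^ 2)) := by
      rw [← ENNReal.ofReal_mul (by positivity), ← ENNReal.ofReal_add (by positivity)
        (by positivity)]
      congr 1
      field_simp
    rw [e, ← lintegral_vertical_inv_sq (by positivity : 0 < w ^ 2) σ.im hw.le]
    refine (enorm_integral_le_lintegral_enorm _).trans ?_
    refine le_trans ?_ (add_le_add_left (mul_le_mul_right (hM _ hv) _) _)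
    rw [← lintegral_const_mul' _ _ ENNReal.ofReal_ne_top, ← lintegral_add_left'
      (((continuous_vertical hf hv).enorm.aemeasurable.pow_const 2).const_mul _)]
    refine lintegral_mono fun ω => ?_
    have hn := norm_vertical_sub_sq (σ.re + w ^ 2) ω σ
    rw [add_sub_cancel_left] at hn
    have hne : (((σ.re + w ^ 2 : ℝ) : ℂ) + ω * I) ≠ σ :=
      sub_ne_zero.1 (vertical_sub_ne_zero (by nlinarith) ω)
    rw [← ofReal_norm, ← ofReal_norm, ← ENNReal.ofReal_pow (norm_nonneg _), hqne _ hne,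
      ← ENNReal.ofReal_mul (by positivity), ← ENNReal.ofReal_add (by positivity) (by positivity)]
    refine ENNReal.ofReal_le_ofReal ?_
    rw [← hn, ← inv_pow]
    set a := ‖f (((σ.re + w ^ 2 : ℝ) : ℂ) + ω * I)‖
    set b := ‖(((σ.re + w ^ 2 : ℝ) : ℂ) + ω * I) - σ‖⁻¹
    have h1 : 0 ≤ (1 / w) * (a - w * b) ^ 2 := by positivity
    have h2 : (1 / w) * (a - w * b) ^ 2 = 1 / w * a ^ 2 + w * b ^ 2 - 2 * (a * b) := by
      field_simp; ring
    have h3 : 0 ≤ a * b := by positivity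
    linarith
  -- The integral is the same on all lines, and it tends to zero far to the right.
  have hconst : ∀ v : ℝ, u ≤ v →
      ∫ ω : ℝ, dslope f σ (u + ω * I) = ∫ ω : ℝ, dslope f σ (v + ω * I) := fun v huv =>
    strip_shift (dslope f σ) (v + 1) (hq.mono fun z hz => hz.1) _
      (ENNReal.add_ne_top.2 ⟨ENNReal.ofReal_ne_top, ENNReal.ofReal_ne_top⟩)
      (fun t ht _ => hbound t ht) hu huv (by linarith)
  have hlim : Tendsto (fun w : ℝ => ENNReal.ofReal ((M + Real.pi) / w)) atTop (𝓝 0) := by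
    rw [← ENNReal.ofReal_zero]
    exact (ENNReal.continuous_ofReal.tendsto 0).comp (tendsto_const_nhds.div_atTop tendsto_id)
  have hle : ‖∫ ω : ℝ, dslope f σ (u + ω * I)‖ₑ ≤ 0 := by
    refine ge_of_tendsto hlim ?_
    filter_upwards [eventually_gt_atTop 0, eventually_ge_atTop u, eventually_ge_atTop 1]
      with w hw hwu hw1
    rw [hconst (σ.re + w ^ 2) (by nlinarith)]
    exact hfar w hw
  exact enorm_eq_zero.1 (le_antisymm hle bot_le)

theorem tendsto_integral_mul_of_eLpNorm {l : Filter ℝ} {φ : ℝ → ℝ → ℂ} {g k : ℝ → ℂ}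
    (hg : MemLp g 2) (hk : MemLp k 2) (hφ : ∀ᶠ ξ in l, AEStronglyMeasurable (φ ξ) volume)
    (h : Tendsto (fun ξ => eLpNorm (fun ω => φ ξ ω - g ω) 2) l (𝓝 0)) :
    Tendsto (fun ξ => ∫ ω, φ ξ ω * k ω) l (𝓝 (∫ ω, g ω * k ω)) := by
  refine tendsto_integral_of_L1 _
    (MemLp.integrable_mul (p := 2) (q := 2) hg hk).aestronglyMeasurable ?_ ?_
  · filter_upwards [hφ, h.eventually_lt_const (by simp : (0 : ℝ≥0∞) < ⊤)] with ξ h1 h2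
    have h3 : MemLp (fun ω => φ ξ ω - g ω) 2 := ⟨h1.sub hg.1, h2⟩
    have h4 : MemLp (φ ξ) 2 := by
      convert h3.add hg using 1
      ext ω; simp
    exact MemLp.integrable_mul (p := 2) (q := 2) h4 hk
  · have ht : Tendsto (fun ξ => eLpNorm (fun ω => φ ξ ω - g ω) 2 * eLpNorm k 2) l (𝓝 0) := by
      simpa using ENNReal.Tendsto.mul_const h (Or.inr hk.2.ne)
    refine tendsto_of_tendsto_of_tendsto_of_le_of_le' tendsto_const_nhds ht
      (Eventually.of_forall fun _ => bot_le) ?_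
    filter_upwards [hφ] with ξ h1
    have := eLpNorm_smul_le_mul_eLpNorm (p := 2) (q := 2) (r := 1) hk.1 (h1.sub hg.1)
    rw [eLpNorm_one_eq_lintegral_enorm] at this
    refine le_trans (le_of_eq (lintegral_congr fun ω => ?_)) this
    simp [sub_mul]

/-- The formula is proved at `σ + u` on the line `Re z = u`, where the kernel `1 / (σ + u - z)`
equals `1 / (σ - iω)` for every `u`. With the kernel fixed, `L²` convergence of the traces suffices
to let `u → 0`. -/
theorem cauchy_formula_boundary {f : ℂ → ℂ} (hf : DifferentiableOn ℂ f {s | 0 < s.re})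
    {M : ℝ} (hM : ∀ ξ : ℝ, 0 < ξ → ∫⁻ ω : ℝ, ‖f (ξ + ω * I)‖ₑ ^ 2 ≤ ENNReal.ofReal M)
    {g : ℝ → ℂ} (hg : IsBoundaryValue f g) {σ : ℂ} (hσ : 0 < σ.re) :
    ∫ ω : ℝ, g ω * (σ - ω * I)⁻¹ = 2 * Real.pi * f σ := by
  have hk := memLp_inv_sub_mul_I hσ
  have hopen : IsOpen {s : ℂ | 0 < s.re} := isOpen_lt continuous_const continuous_re
  have hline : ∀ u : ℝ, 0 < u → u < σ.re →
      ∫ ω : ℝ, f (u + ω * I) * (σ - ω * I)⁻¹ = 2 * Real.pi * f (σ + u) := by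
    intro u hu huσ
    -- The pole `a` mirrors `σ + u` in the line `Re z = u`, and `α / (z - a)` takes the value `f(σ +
    -- u)` at `σ + u`. Subtracting it creates the required zero; the bound `u < Re σ` keeps `a` in
    -- the left half-plane.
    set α : ℂ := f (σ + u) * (2 * σ.re) with hα
    set a : ℂ := u - conj σ with ha
    have hare : a.re < 0 := by simp [ha]; linarith
    set h : ℂ → ℂ := fun z => f z - α * (z - a)⁻¹ with hh
    have hane : ∀ z : ℂ, 0 < z.re → z - a ≠ 0 := by
      intro z hz h0
      have := congrArg re h0
      rw [sub_re, zero_re] at this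
      linarith
    have hh1 : DifferentiableOn ℂ h {s | 0 < s.re} :=
      hf.sub ((DifferentiableOn.inv (by fun_prop) hane).const_mul α)
    have hσu : σ + u - a = 2 * σ.re := by
      have := add_conj σ
      push_cast at this
      rw [ha, ← this]; ring
    have hσne : (2 * σ.re : ℂ) ≠ 0 := by
      simpa using hσ.ne'
    have hh0 : h (σ + u) = 0 := by
      simp only [hh]
      rw [hσu, hα, mul_inv_cancel_right₀ hσne, sub_self]
    have hM' : ∀ ξ : ℝ, 0 < ξ → ∫⁻ ω : ℝ, ‖h (ξ + ω * I)‖ₑ ^ 2 ≤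
        ENNReal.ofReal (2 * (max M 0 + ‖α‖ ^ 2 * (Real.pi / (-a.re)))) := by
      intro ξ hξ
      have hk2 := lintegral_vertical_inv (x := ξ) (a := a) (by linarith)
      calc ∫⁻ ω : ℝ, ‖h (ξ + ω * I)‖ₑ ^ 2
          ≤ ∫⁻ ω : ℝ, 2 * (‖f (ξ + ω * I)‖ₑ ^ 2 + ‖α‖ₑ ^ 2 * ‖((ξ + ω * I : ℂ) - a)⁻¹‖ₑ ^ 2) := by
            refine lintegral_mono fun ω => ?_
            rw [← mul_pow, ← enorm_mul]
            refine (pow_le_pow_left₀ (by simp) enorm_sub_le 2).trans ?_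
            have := ENNReal.rpow_add_le_mul_rpow_add_rpow ‖f (ξ + ω * I)‖ₑ
              ‖α * ((ξ + ω * I : ℂ) - a)⁻¹‖ₑ (p := 2) (by norm_num)
            norm_num at this
            simpa using this
        _ = 2 * ((∫⁻ ω : ℝ, ‖f (ξ + ω * I)‖ₑ ^ 2) +
            ‖α‖ₑ ^ 2 * ENNReal.ofReal (Real.pi / (ξ - a.re))) := by
            rw [lintegral_const_mul' _ _ (by simp), lintegral_add_left'
              ((continuous_vertical hf hξ).enorm.aemeasurable.pow_const 2),
              lintegral_const_mul' _ _ (by simp), hk2]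
        _ ≤ 2 * (ENNReal.ofReal (max M 0) +
            ENNReal.ofReal (‖α‖ ^ 2) * ENNReal.ofReal (Real.pi / (-a.re))) := by
            rw [← ofReal_norm α, ← ENNReal.ofReal_pow (norm_nonneg _)]
            gcongr
            · exact (hM ξ hξ).trans (ENNReal.ofReal_le_ofReal (le_max_left _ _))
            · linarith
            · linarith
        _ = _ := by
            have : 0 < -a.re := by linarith
            rw [← ENNReal.ofReal_mul (by positivity), ← ENNReal.ofReal_add (by positivity)
              (by positivity), ENNReal.ofReal_mul (by norm_num)]
            simp
    have key := integral_dslope_vertical_eq_zero hh1 hM' (by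
      have : 0 < -a.re := by linarith
      positivity) (σ := σ + u) (by simp; linarith) hh0 hu
    have hne : ∀ ω : ℝ, σ - ω * I ≠ 0 := by
      intro ω h0
      have := congrArg re h0
      simp at this
      linarith
    -- On the line, `z - a` is the conjugate of `σ - iω`, so the subtracted term becomes a Poisson
    -- kernel, with integral `π / Re σ`.
    have e : ∀ ω : ℝ, dslope h (σ + u) (u + ω * I) = α * (((σ.re ^ 2 + (ω - σ.im) ^ 2)⁻¹ : ℝ) : ℂ) -
        f (u + ω * I) * (σ - ω * I)⁻¹ := by
      intro ω
      have h1 : (u + ω * I : ℂ) ≠ σ + u := by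
        intro h0
        apply hne ω
        linear_combination -h0
      have h2 : (u + ω * I : ℂ) - (σ + u) = -(σ - ω * I) := by ring
      have h3 : (u + ω * I : ℂ) - a = conj (σ - ω * I) := by simp [ha]; ring
      have h4 : ((σ.re ^ 2 + (ω - σ.im) ^ 2 : ℝ) : ℂ) = (σ - ω * I) * conj (σ - ω * I) := by
        rw [mul_conj, normSq_apply]
        congr 1
        simp
        ring
      have h5 : conj (σ - ω * I) ≠ 0 := (map_ne_zero _).2 (hne ω)
      rw [dslope_of_ne _ h1, slope_def_field, hh0, sub_zero, h2, ofReal_inv, h4]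
      simp only [hh]
      rw [h3]
      field_simp [hne ω]
      ring
    simp only [e] at key
    have hfu : MemLp (fun ω : ℝ => f (u + ω * I)) 2 :=
      ⟨(continuous_vertical hf hu).aestronglyMeasurable,
        (eLpNorm_two_lt_top_iff _).2 ((hM u hu).trans_lt ENNReal.ofReal_lt_top)⟩
    have hfk : Integrable fun ω : ℝ => f (u + ω * I) * (σ - ω * I)⁻¹ :=
      MemLp.integrable_mul (p := 2) (q := 2) hfu hk
    have hpk : Integrable fun ω : ℝ => α * (((σ.re ^ 2 + (ω - σ.im) ^ 2)⁻¹ : ℝ) : ℂ) :=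
      ((integrable_vertical_inv_sq hσ.ne' σ.im).ofReal).const_mul α
    rw [integral_sub hpk hfk, integral_const_mul, integral_complex_ofReal,
      integral_vertical_inv_sq hσ] at key
    rw [← sub_eq_zero.1 key, hα]
    push_cast
    have : (σ.re : ℂ) ≠ 0 := by simpa using hσ.ne'
    field_simp
  have h1 : Tendsto (fun u : ℝ => ∫ ω : ℝ, f (u + ω * I) * (σ - ω * I)⁻¹) (𝓝[>] 0)
      (𝓝 (∫ ω : ℝ, g ω * (σ - ω * I)⁻¹)) := by
    refine tendsto_integral_mul_of_eLpNorm hg.1 hk ?_ hg.2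
    filter_upwards [self_mem_nhdsWithin] with u hu
    exact (continuous_vertical hf hu).aestronglyMeasurable
  have h2 : Tendsto (fun u : ℝ => 2 * Real.pi * f (σ + u)) (𝓝[>] 0) (𝓝 (2 * Real.pi * f σ)) := by
    have hc : ContinuousAt f σ := (hf.continuousOn).continuousAt (hopen.mem_nhds hσ)
    have h3 : Tendsto (fun u : ℝ => σ + (u : ℂ)) (𝓝[>] 0) (𝓝 σ) := by
      have : Continuous fun u : ℝ => σ + (u : ℂ) := by fun_prop
      simpa using (this.tendsto 0).mono_left nhdsWithin_le_nhds
    exact (hc.tendsto.comp h3).const_mul _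
  refine tendsto_nhds_unique h1 (h2.congr' ?_)
  filter_upwards [Ioo_mem_nhdsGT hσ] with u hu
  exact (hline u hu.1 hu.2).symm

theorem cauchy_formula_deriv_boundary {f : ℂ → ℂ} (hf : DifferentiableOn ℂ f {s | 0 < s.re})
    {M : ℝ} (hM : ∀ ξ : ℝ, 0 < ξ → ∫⁻ ω : ℝ, ‖f (ξ + ω * I)‖ₑ ^ 2 ≤ ENNReal.ofReal M)
    {g : ℝ → ℂ} (hg : IsBoundaryValue f g) {σ : ℂ} (hσ : 0 < σ.re) :
    ∫ ω : ℝ, g ω * ((σ - ω * I)⁻¹) ^ 2 = -(2 * Real.pi * deriv f σ) := by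
  have hk : ∀ s : ℂ, 0 < s.re → MemLp (fun ω : ℝ => (s - ω * I)⁻¹) 2 := fun s hs =>
    memLp_inv_sub_mul_I hs
  have hopen : IsOpen {s : ℂ | 0 < s.re} := isOpen_lt continuous_const continuous_re
  have hre : ∀ (s : ℂ) (ω : ℝ), s.re ≤ ‖s - ω * I‖ := by
    intro s ω
    have := re_le_norm (s - ω * I)
    simpa using this
  have hball : ∀ s ∈ Metric.ball σ (σ.re / 2), 0 < s.re := by
    intro s hs
    have h1 := (abs_re_le_norm (s - σ)).trans_lt (mem_ball_iff_norm.1 hs)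
    rw [sub_re, abs_lt] at h1
    linarith [h1.1]
  have hint := MemLp.integrable_mul (p := 2) (q := 2) hg.1 (hk σ hσ)
  -- Cauchy's formula is differentiated in `σ` under the integral. On the ball of radius `Re σ / 2`,
  -- `|s - iω| ≥ |σ - iω| / 2`; squaring gives the factor `4`, and one of the two inverse factors is
  -- bounded by `1 / Re σ`.
  have hder := hasDerivAt_integral_of_dominated_loc_of_deriv_le (μ := volume)
    (F := fun (s : ℂ) (ω : ℝ) => g ω * (s - ω * I)⁻¹)
    (F' := fun (s : ℂ) (ω : ℝ) => -(g ω * ((s - ω * I)⁻¹) ^ 2))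
    (bound := fun ω => 4 / σ.re * ‖g ω * (σ - ω * I)⁻¹‖)
    (x₀ := σ) (Metric.ball_mem_nhds σ (half_pos hσ)) ?_ hint
    ((hg.1.1.mul ((hk σ hσ).1.pow 2)).neg) ?_ (hint.norm.const_mul _) ?_
  · have hev : (fun s => ∫ ω : ℝ, g ω * (s - ω * I)⁻¹) =ᶠ[𝓝 σ] fun s => 2 * Real.pi * f s := by
      filter_upwards [hopen.mem_nhds hσ] with s hs
      exact cauchy_formula_boundary hf hM hg hs
    have h1 := hder.2.congr_of_eventuallyEq hev.symm
    have h2 := ((hf.differentiableAt (hopen.mem_nhds hσ)).hasDerivAt).const_mul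
      (2 * Real.pi : ℂ)
    have h3 := h1.unique h2
    rw [integral_neg] at h3
    rw [← h3, neg_neg]
  · filter_upwards [hopen.mem_nhds hσ] with s hs
    exact hg.1.1.mul (hk s hs).1
  · refine Eventually.of_forall fun ω s hs => ?_
    have hs0 := hball s hs
    have h1 : ‖σ - ω * I‖ ≤ 2 * ‖s - ω * I‖ := by
      have h2 := mem_ball_iff_norm'.1 hs
      have h3 : ‖σ - ω * I‖ ≤ ‖σ - s‖ + ‖s - ω * I‖ := by
        have : σ - ω * I = (σ - s) + (s - ω * I) := by ring
        rw [this]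
        exact norm_add_le _ _
      have h4 := hre σ ω
      linarith
    have hp : 0 < ‖s - ω * I‖ := hs0.trans_le (hre s ω)
    have hp2 : 0 < ‖σ - ω * I‖ := hσ.trans_le (hre σ ω)
    have h5 : ‖s - ω * I‖⁻¹ ≤ 2 * ‖σ - ω * I‖⁻¹ := by
      rw [← div_eq_mul_inv, inv_le_iff_one_le_mul₀ hp, div_mul_eq_mul_div, le_div_iff₀ hp2]
      linarith
    have h6 : ‖σ - ω * I‖⁻¹ ≤ (σ.re)⁻¹ := inv_anti₀ hσ (hre σ ω)
    rw [norm_neg, norm_mul, norm_mul, norm_pow, norm_inv, norm_inv]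
    calc ‖g ω‖ * (‖s - ω * I‖⁻¹) ^ 2 ≤ ‖g ω‖ * (2 * ‖σ - ω * I‖⁻¹) ^ 2 := by gcongr
      _ = 4 * ‖σ - ω * I‖⁻¹ * (‖g ω‖ * ‖σ - ω * I‖⁻¹) := by ring
      _ ≤ 4 * (σ.re)⁻¹ * (‖g ω‖ * ‖σ - ω * I‖⁻¹) := by gcongr
      _ = _ := by ring
  · refine Eventually.of_forall fun ω s hs => ?_
    have hne : s - ω * I ≠ 0 := norm_pos_iff.1 ((hball s hs).trans_le (hre s ω))
    have h1 := (((hasDerivAt_id s).sub_const (ω * I : ℂ)).inv hne).const_mul (g ω)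
    refine h1.congr_deriv ?_
    simp only [id]
    field_simp

/-! ### Simple and double poles as reproducing kernels -/

namespace Hardy

variable {p m : ℕ}

theorem entry_bound (F : Hardy p m) (i : Fin p) (j : Fin m) :
    ∃ M : ℝ, ∀ ξ : ℝ, 0 < ξ → ∫⁻ ω : ℝ, ‖F (ξ + ω * I) i j‖ₑ ^ 2 ≤ ENNReal.ofReal M := by
  obtain ⟨-, h2, -⟩ := F.2
  refine ⟨(⨆ ξ ∈ Set.Ioi (0 : ℝ), ∫⁻ ω : ℝ, ∑ i, ∑ j, ‖F.1 (ξ + ω * I) i j‖ₑ ^ 2).toReal,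
    fun ξ hξ => ?_⟩
  rw [ENNReal.ofReal_toReal h2.ne]
  refine le_trans (lintegral_mono fun ω => ?_) (le_iSup₂ (f := fun (ξ : ℝ)
    (_ : ξ ∈ Set.Ioi (0 : ℝ)) => ∫⁻ ω : ℝ, ∑ i, ∑ j, ‖F.1 (ξ + ω * I) i j‖ₑ ^ 2) ξ hξ)
  refine le_trans ?_ (Finset.single_le_sum
    (f := fun i => ∑ j, ‖F.1 (ξ + ω * I) i j‖ₑ ^ 2) (fun _ _ => by simp) (Finset.mem_univ i))
  exact Finset.single_le_sum (f := fun j => ‖F.1 (ξ + ω * I) i j‖ₑ ^ 2)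
    (fun _ _ => by simp) (Finset.mem_univ j)

theorem integral_boundary_mul_inv (F : Hardy p m) (i : Fin p) (j : Fin m) {σ : ℂ}
    (hσ : 0 < σ.re) :
    ∫ ω : ℝ, F.boundary ω i j * (σ - ω * I)⁻¹ = 2 * Real.pi * F σ i j := by
  obtain ⟨M, hM⟩ := F.entry_bound i j
  exact cauchy_formula_boundary (F.2.1 i j) hM (F.isBoundaryValue i j) hσ

theorem integral_boundary_mul_inv_sq (F : Hardy p m) (i : Fin p) (j : Fin m) {σ : ℂ}
    (hσ : 0 < σ.re) :
    ∫ ω : ℝ, F.boundary ω i j * ((σ - ω * I)⁻¹) ^ 2 = -(2 * Real.pi * F.derivative σ i j) := by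
  obtain ⟨M, hM⟩ := F.entry_bound i j
  exact cauchy_formula_deriv_boundary (F.2.1 i j) hM (F.isBoundaryValue i j) hσ

/-- The matrix function `s ↦ φ s • M` for a scalar Hardy function `φ`. -/
noncomputable def ofScalar (φ : ℂ → ℂ) (hd : DifferentiableOn ℂ φ {s | 0 < s.re})
    (hb : ∃ C : ℝ, ∀ ξ : ℝ, 0 < ξ → ∫⁻ ω : ℝ, ‖φ (ξ + ω * I)‖ₑ ^ 2 ≤ ENNReal.ofReal C)
    (M : Matrix (Fin p) (Fin m) ℂ) : Hardy p m :=
  ⟨fun s => if 0 < s.re then φ s • M else 0, by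
    refine ⟨fun i j => ?_, ?_, fun s hs => by simp [hs]⟩
    · refine (hd.mul_const (M i j)).congr fun s hs => ?_
      have hs' : 0 < s.re := hs
      simp [hs']
    · obtain ⟨C, hC⟩ := hb
      refine lt_of_le_of_lt (iSup₂_le (a := (∑ i, ∑ j, ‖M i j‖ₑ ^ 2) * ENNReal.ofReal C)
        fun ξ hξ => ?_) (ENNReal.mul_lt_top ?_ ENNReal.ofReal_lt_top)
      · have hξ' : 0 < ξ := hξ
        refine le_trans (le_of_eq ?_) (mul_le_mul_right (hC ξ hξ) (∑ i, ∑ j, ‖M i j‖ₑ ^ 2))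
        rw [← lintegral_const_mul' _ _ ?_]
        · refine lintegral_congr fun ω => ?_
          simp only [Finset.sum_mul]
          refine Finset.sum_congr rfl fun i _ => Finset.sum_congr rfl fun j _ => ?_
          simp [hξ', enorm_mul, mul_pow, mul_comm]
        · simp [ENNReal.sum_eq_top]
      · simp [lt_top_iff_ne_top, ENNReal.sum_eq_top]⟩

theorem ofScalar_apply {φ : ℂ → ℂ} (hd : DifferentiableOn ℂ φ {s | 0 < s.re})
    (hb : ∃ C : ℝ, ∀ ξ : ℝ, 0 < ξ → ∫⁻ ω : ℝ, ‖φ (ξ + ω * I)‖ₑ ^ 2 ≤ ENNReal.ofReal C)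
    (M : Matrix (Fin p) (Fin m) ℂ) {s : ℂ} (hs : 0 < s.re) : ofScalar φ hd hb M s = φ s • M :=
  if_pos hs

theorem boundary_ofScalar {φ : ℂ → ℂ} (hd : DifferentiableOn ℂ φ {s | 0 < s.re})
    (hb : ∃ C : ℝ, ∀ ξ : ℝ, 0 < ξ → ∫⁻ ω : ℝ, ‖φ (ξ + ω * I)‖ₑ ^ 2 ≤ ENNReal.ofReal C)
    (M : Matrix (Fin p) (Fin m) ℂ) {ψ : ℝ → ℂ} (hψ : IsBoundaryValue φ ψ) :
    ∀ᵐ ω : ℝ, (ofScalar φ hd hb M).boundary ω = ψ ω • M := by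
  have h : ∀ i j, ∀ᵐ ω : ℝ, (ofScalar φ hd hb M).boundary ω i j = M i j * ψ ω := by
    intro i j
    refine ((ofScalar φ hd hb M).isBoundaryValue i j).unique ((ofScalar φ hd hb M).2.1 i j) ?_
    refine ⟨(hψ.const_mul (M i j)).1, (hψ.const_mul (M i j)).2.congr' ?_⟩
    filter_upwards [self_mem_nhdsWithin] with ξ hξ
    have hξ' : 0 < ξ := hξ
    congr 1
    ext ω
    rw [ofScalar_apply hd hb M (by simpa using hξ'), Matrix.smul_apply, smul_eq_mul, mul_comm]
  simp only [← ae_all_iff] at h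
  filter_upwards [h] with ω hω
  ext i j
  rw [hω i j, Matrix.smul_apply, smul_eq_mul, mul_comm]

/-- Reduces a reproducing property to scalar integrals: `N` stands for the value, or the negated
derivative, that the kernel `conj ψ` extracts from each entry of `F`. -/
theorem inner_ofScalar {φ : ℂ → ℂ} (hd : DifferentiableOn ℂ φ {s | 0 < s.re})
    (hb : ∃ C : ℝ, ∀ ξ : ℝ, 0 < ξ → ∫⁻ ω : ℝ, ‖φ (ξ + ω * I)‖ₑ ^ 2 ≤ ENNReal.ofReal C)
    (M : Matrix (Fin p) (Fin m) ℂ) {ψ : ℝ → ℂ} (hψ : IsBoundaryValue φ ψ) (F : Hardy p m)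
    {N : Matrix (Fin p) (Fin m) ℂ}
    (hN : ∀ i j, ∫ ω : ℝ, F.boundary ω i j * conj (ψ ω) = 2 * Real.pi * N i j) :
    inner ℂ (ofScalar φ hd hb M) F = Matrix.trace (Mᴴ * N) := by
  have hi : ∀ i j, Integrable fun ω : ℝ => conj (M i j) * (F.boundary ω i j * conj (ψ ω)) :=
    fun i j => (MemLp.integrable_mul (p := 2) (q := 2) (F.isBoundaryValue i j).1
      hψ.1.star).const_mul _
  have h1 : ∫ ω : ℝ, Matrix.trace (((ofScalar φ hd hb M).boundary ω)ᴴ * F.boundary ω) =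
      ∫ ω : ℝ, ∑ j, ∑ i, conj (M i j) * (F.boundary ω i j * conj (ψ ω)) := by
    refine integral_congr_ae ?_
    filter_upwards [boundary_ofScalar hd hb M hψ] with ω hω
    rw [hω]
    simp only [Matrix.trace, Matrix.diag, Matrix.mul_apply, Matrix.conjTranspose_apply,
      Matrix.smul_apply, smul_eq_mul, star_mul', RCLike.star_def]
    refine Finset.sum_congr rfl fun j _ => Finset.sum_congr rfl fun i _ => ?_
    ring
  rw [inner_def, h1, integral_finsetSum _ fun j _ => integrable_finsetSum _ fun i _ => hi i j]
  simp only [Matrix.trace, Matrix.diag, Matrix.mul_apply, Matrix.conjTranspose_apply,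
    RCLike.star_def, Finset.mul_sum]
  refine Finset.sum_congr rfl fun j _ => ?_
  rw [integral_finsetSum _ fun i _ => hi i j, Finset.mul_sum]
  refine Finset.sum_congr rfl fun i _ => ?_
  rw [integral_const_mul, hN]
  have : (Real.pi : ℂ) ≠ 0 := by simp [Real.pi_ne_zero]
  field_simp

theorem sub_ne_zero_of_re {a s : ℂ} (ha : a.re < 0) (hs : 0 < s.re) : s - a ≠ 0 := by
  intro h0
  have := congrArg re h0
  rw [sub_re, zero_re] at this
  linarith

theorem norm_vertical_inv_le {x : ℝ} {a : ℂ} (ha : a.re < 0) (hx : 0 ≤ x) (ω : ℝ) :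
    ‖((x + ω * I : ℂ) - a)⁻¹‖ ≤ (-a.re)⁻¹ := by
  rw [norm_inv]
  refine inv_anti₀ (by linarith) ?_
  have := re_le_norm ((x + ω * I : ℂ) - a)
  simp at this
  linarith

theorem differentiableOn_pole {a : ℂ} (ha : a.re < 0) :
    DifferentiableOn ℂ (fun s : ℂ => (s - a)⁻¹) {s | 0 < s.re} :=
  DifferentiableOn.inv (by fun_prop) fun _ hs => sub_ne_zero_of_re ha hs

theorem bound_pole {a : ℂ} (ha : a.re < 0) : ∃ C : ℝ, ∀ ξ : ℝ, 0 < ξ →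
    ∫⁻ ω : ℝ, ‖((ξ + ω * I : ℂ) - a)⁻¹‖ₑ ^ 2 ≤ ENNReal.ofReal C := by
  refine ⟨Real.pi / (-a.re), fun ξ hξ => ?_⟩
  rw [lintegral_vertical_inv (by linarith)]
  refine ENNReal.ofReal_le_ofReal ?_
  have : 0 < -a.re := by linarith
  gcongr
  linarith

theorem isBoundaryValue_pole {a : ℂ} (ha : a.re < 0) :
    IsBoundaryValue (fun s : ℂ => (s - a)⁻¹) (fun ω : ℝ => (ω * I - a)⁻¹) := by
  have hL : MemLp (fun ω : ℝ => (ω * I - a)⁻¹) 2 := by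
    simpa using memLp_vertical_inv (x := 0) ha
  refine ⟨hL, ?_⟩
  have ht : Tendsto (fun ξ : ℝ => ENNReal.ofReal (ξ * (-a.re)⁻¹) *
      eLpNorm (fun ω : ℝ => (ω * I - a)⁻¹) 2) (𝓝[>] 0) (𝓝 0) := by
    have h1 : Tendsto (fun ξ : ℝ => ENNReal.ofReal (ξ * (-a.re)⁻¹)) (𝓝[>] 0) (𝓝 0) := by
      have : Continuous fun ξ : ℝ => ENNReal.ofReal (ξ * (-a.re)⁻¹) :=
        ENNReal.continuous_ofReal.comp (by fun_prop)
      simpa using (this.tendsto 0).mono_left nhdsWithin_le_nhds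
    simpa using ENNReal.Tendsto.mul_const h1 (Or.inr hL.2.ne)
  refine tendsto_of_tendsto_of_tendsto_of_le_of_le' tendsto_const_nhds ht
    (Eventually.of_forall fun _ => bot_le) ?_
  filter_upwards [self_mem_nhdsWithin] with ξ hξ
  have hξ' : 0 < ξ := hξ
  refine eLpNorm_le_mul_eLpNorm_of_ae_le_mul (Eventually.of_forall fun ω => ?_) 2
  have h1 : (ξ + ω * I : ℂ) - a ≠ 0 := vertical_sub_ne_zero (by linarith) ω
  have h2 : (ω * I : ℂ) - a ≠ 0 := by simpa using vertical_sub_ne_zero ha ω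
  -- The difference is the boundary function times `ξ` and a factor bounded by `1 / (-Re a)`, so its
  -- `L²` norm is `O(ξ)`.
  have e : ((ξ + ω * I : ℂ) - a)⁻¹ - (ω * I - a)⁻¹ =
      -(ξ * ((ξ + ω * I : ℂ) - a)⁻¹ * (ω * I - a)⁻¹) := by
    field_simp
    ring
  rw [e, norm_neg, norm_mul, norm_mul, norm_real, Real.norm_of_nonneg hξ'.le]
  gcongr
  exact norm_vertical_inv_le ha hξ'.le ω

theorem bound_pole_sq {a : ℂ} (ha : a.re < 0) : ∃ C : ℝ, ∀ ξ : ℝ, 0 < ξ →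
    ∫⁻ ω : ℝ, ‖(((ξ + ω * I : ℂ) - a)⁻¹) ^ 2‖ₑ ^ 2 ≤ ENNReal.ofReal C := by
  obtain ⟨C, hC⟩ := bound_pole ha
  refine ⟨((-a.re)⁻¹) ^ 2 * C, fun ξ hξ => ?_⟩
  rw [ENNReal.ofReal_mul (by positivity)]
  refine le_trans ?_ (mul_le_mul_right (hC ξ hξ) _)
  rw [← lintegral_const_mul' _ _ ENNReal.ofReal_ne_top]
  refine lintegral_mono fun ω => ?_
  have h1 := norm_vertical_inv_le ha hξ.le ω
  rw [enorm_pow, ← ofReal_norm, ENNReal.ofReal_pow (by simp; linarith), ← mul_pow, sq, sq, sq]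
  gcongr

theorem isBoundaryValue_pole_sq {a : ℂ} (ha : a.re < 0) :
    IsBoundaryValue (fun s : ℂ => ((s - a)⁻¹) ^ 2) (fun ω : ℝ => ((ω * I - a)⁻¹) ^ 2) := by
  obtain ⟨hL, ht⟩ := isBoundaryValue_pole ha
  have hb : ∀ ω : ℝ, ‖((ω * I : ℂ) - a)⁻¹‖ ≤ (-a.re)⁻¹ := fun ω => by
    simpa using norm_vertical_inv_le ha le_rfl ω
  refine ⟨hL.of_le_mul (c := (-a.re)⁻¹) (hL.1.pow 2) (Eventually.of_forall fun ω => ?_), ?_⟩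
  · rw [norm_pow, sq]
    gcongr
    exact hb ω
  · have ht2 := ENNReal.Tendsto.const_mul (a := ENNReal.ofReal ((-a.re)⁻¹ + (-a.re)⁻¹)) ht
      (Or.inr ENNReal.ofReal_ne_top)
    rw [mul_zero] at ht2
    refine tendsto_of_tendsto_of_tendsto_of_le_of_le' tendsto_const_nhds ht2
      (Eventually.of_forall fun _ => bot_le) ?_
    filter_upwards [self_mem_nhdsWithin] with ξ hξ
    have hξ' : 0 < ξ := hξ
    refine eLpNorm_le_mul_eLpNorm_of_ae_le_mul (Eventually.of_forall fun ω => ?_) 2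
    rw [sq_sub_sq, norm_mul]
    gcongr
    exact (norm_add_le _ _).trans (add_le_add (norm_vertical_inv_le ha hξ'.le ω) (hb ω))

/-- `s ↦ (s - a)⁻¹ • M` with the pole `a` in the open left half-plane. -/
noncomputable def simplePole {a : ℂ} (ha : a.re < 0) (M : Matrix (Fin p) (Fin m) ℂ) :
    Hardy p m :=
  ofScalar (fun s : ℂ => (s - a)⁻¹) (differentiableOn_pole ha) (bound_pole ha) M

/-- `s ↦ (s - a)⁻² • M` with the pole `a` in the open left half-plane. -/
noncomputable def doublePole {a : ℂ} (ha : a.re < 0) (M : Matrix (Fin p) (Fin m) ℂ) :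
    Hardy p m :=
  ofScalar (fun s : ℂ => ((s - a)⁻¹) ^ 2) ((differentiableOn_pole ha).pow 2) (bound_pole_sq ha) M

theorem simplePole_apply {a : ℂ} (ha : a.re < 0) (M : Matrix (Fin p) (Fin m) ℂ) {s : ℂ}
    (hs : 0 < s.re) : simplePole ha M s = (s - a)⁻¹ • M :=
  ofScalar_apply _ _ M hs

theorem doublePole_apply {a : ℂ} (ha : a.re < 0) (M : Matrix (Fin p) (Fin m) ℂ) {s : ℂ}
    (hs : 0 < s.re) : doublePole ha M s = ((s - a)⁻¹) ^ 2 • M :=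
  ofScalar_apply _ _ M hs

/-- This reflection is why interpolation takes place at the mirror images `-conj (lam i)` of the
poles. -/
theorem conj_inv_mul_I_sub (a : ℂ) (ω : ℝ) :
    conj ((ω * I - a)⁻¹) = (-conj a - ω * I)⁻¹ := by
  rw [map_inv₀]
  congr 1
  simp
  ring

theorem inner_simplePole {a : ℂ} (ha : a.re < 0) (M : Matrix (Fin p) (Fin m) ℂ) (F : Hardy p m) :
    inner ℂ (simplePole ha M) F = Matrix.trace (Mᴴ * F (-conj a)) := by
  refine inner_ofScalar _ _ M (isBoundaryValue_pole ha) F fun i j => ?_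
  simp only [conj_inv_mul_I_sub]
  exact F.integral_boundary_mul_inv i j (by simpa using ha)

theorem inner_doublePole {a : ℂ} (ha : a.re < 0) (M : Matrix (Fin p) (Fin m) ℂ) (F : Hardy p m) :
    inner ℂ (doublePole ha M) F = -Matrix.trace (Mᴴ * F.derivative (-conj a)) := by
  rw [← Matrix.trace_neg, ← Matrix.mul_neg]
  refine inner_ofScalar _ _ M (isBoundaryValue_pole_sq ha) F fun i j => ?_
  simp only [map_pow, conj_inv_mul_I_sub]
  rw [F.integral_boundary_mul_inv_sq i j (by simpa using ha), Matrix.neg_apply, mul_neg]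

/-- Exhibits entry evaluation as pairing with a fixed element, so that it is a bounded functional.
-/
theorem inner_simplePole_single {s : ℂ} (hs : 0 < s.re) (i : Fin p) (j : Fin m) (F : Hardy p m) :
    inner ℂ (simplePole (a := -conj s) (by simpa using hs) (Matrix.single i j 1)) F = F s i j := by
  rw [inner_simplePole, map_neg, conj_conj, neg_neg, Matrix.conjTranspose_single, star_one,
    Matrix.trace_single_mul, one_smul]

/-- Point evaluations are continuous, so they commute with differentiation along a curve. -/
theorem hasDerivAt_eval {c : ℝ → Hardy p m} {v : Hardy p m} {t : ℝ} (h : HasDerivAt c v t) {s : ℂ}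
    (hs : 0 < s.re) (i : Fin p) (j : Fin m) :
    HasDerivAt (fun u => c u s i j) (v s i j) t := by
  have h1 := ((innerSL ℂ (simplePole (p := p) (m := m) (a := -conj s) (by simpa using hs)
    (Matrix.single i j 1))).restrictScalars ℝ).hasFDerivAt.comp_hasDerivAt t h
  have e : (fun u => c u s i j) = fun u => inner ℂ (simplePole (a := -conj s) (by simpa using hs)
      (Matrix.single i j 1)) (c u) := funext fun u => (inner_simplePole_single hs i j (c u)).symm
  rw [e, ← inner_simplePole_single hs i j v]
  exact h1

end Hardy

/-! ### Loewner realizations and the velocities of curves of rational functions -/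

theorem isUnit_smul_one_sub {r : ℕ} {A : Matrix (Fin r) (Fin r) ℂ} {s : ℂ} (h : s ∉ spectrum ℂ A) :
    IsUnit (s • (1 : Matrix (Fin r) (Fin r) ℂ) - A) := by
  rw [spectrum.notMem_iff, Algebra.algebraMap_eq_smul_one] at h
  exact h

theorem IsHurwitz.notMem_spectrum {r : ℕ} {A : Matrix (Fin r) (Fin r) ℂ} (hA : IsHurwitz A) {s : ℂ}
    (hs : 0 ≤ s.re) : s ∉ spectrum ℂ A := fun h => absurd (hA s h) (not_lt.2 hs)

theorem IsHurwitz.isUnit {r : ℕ} {A : Matrix (Fin r) (Fin r) ℂ} (hA : IsHurwitz A) {s : ℂ}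
    (hs : 0 ≤ s.re) : IsUnit (s • (1 : Matrix (Fin r) (Fin r) ℂ) - A) :=
  isUnit_smul_one_sub (hA.notMem_spectrum hs)

/-- `(θ - τ)(s - A) = (s - τ)(θ - A) - (s - θ)(τ - A)`, so each term cancels one resolvent. -/
theorem resolvent_mul_mul_resolvent {r : ℕ} {A : Matrix (Fin r) (Fin r) ℂ} {θ τ : ℂ}
    (hθ : IsUnit (θ • (1 : Matrix (Fin r) (Fin r) ℂ) - A))
    (hτ : IsUnit (τ • (1 : Matrix (Fin r) (Fin r) ℂ) - A)) (hne : θ ≠ τ) (s : ℂ) :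
    (θ • (1 : Matrix (Fin r) (Fin r) ℂ) - A)⁻¹ * (s • (1 : Matrix (Fin r) (Fin r) ℂ) - A) *
      (τ • (1 : Matrix (Fin r) (Fin r) ℂ) - A)⁻¹ =
    (θ - τ)⁻¹ • ((s - τ) • (τ • (1 : Matrix (Fin r) (Fin r) ℂ) - A)⁻¹ -
      (s - θ) • (θ • (1 : Matrix (Fin r) (Fin r) ℂ) - A)⁻¹) := by
  have hθτ : θ - τ ≠ 0 := sub_ne_zero.2 hne
  rw [Matrix.isUnit_iff_isUnit_det] at hθ hτ
  have e : s • (1 : Matrix (Fin r) (Fin r) ℂ) - A = (θ - τ)⁻¹ •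
      ((s - τ) • (θ • (1 : Matrix (Fin r) (Fin r) ℂ) - A) -
        (s - θ) • (τ • (1 : Matrix (Fin r) (Fin r) ℂ) - A)) := by
    rw [eq_inv_smul_iff₀ hθτ]
    module
  rw [e, Matrix.mul_smul, Matrix.smul_mul, Matrix.mul_sub, Matrix.sub_mul, Matrix.mul_smul,
    Matrix.mul_smul, Matrix.smul_mul, Matrix.smul_mul, Matrix.nonsing_inv_mul _ hθ, Matrix.one_mul,
    Matrix.mul_assoc, Matrix.mul_nonsing_inv _ hτ, Matrix.mul_one]

theorem resolvent_mul_resolvent {r : ℕ} {A : Matrix (Fin r) (Fin r) ℂ} {θ τ : ℂ}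
    (hθ : IsUnit (θ • (1 : Matrix (Fin r) (Fin r) ℂ) - A))
    (hτ : IsUnit (τ • (1 : Matrix (Fin r) (Fin r) ℂ) - A)) (hne : θ ≠ τ) :
    (θ • (1 : Matrix (Fin r) (Fin r) ℂ) - A)⁻¹ * (τ • (1 : Matrix (Fin r) (Fin r) ℂ) - A)⁻¹ =
    (θ - τ)⁻¹ • ((τ • (1 : Matrix (Fin r) (Fin r) ℂ) - A)⁻¹ -
      (θ • (1 : Matrix (Fin r) (Fin r) ℂ) - A)⁻¹) := by
  have hθτ : θ - τ ≠ 0 := sub_ne_zero.2 hne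
  rw [Matrix.isUnit_iff_isUnit_det] at hθ hτ
  have e : (1 : Matrix (Fin r) (Fin r) ℂ) = (θ - τ)⁻¹ •
      ((θ • (1 : Matrix (Fin r) (Fin r) ℂ) - A) - (τ • (1 : Matrix (Fin r) (Fin r) ℂ) - A)) := by
    rw [eq_inv_smul_iff₀ hθτ]
    module
  calc _ = (θ • (1 : Matrix (Fin r) (Fin r) ℂ) - A)⁻¹ * ((θ - τ)⁻¹ •
      ((θ • (1 : Matrix (Fin r) (Fin r) ℂ) - A) - (τ • (1 : Matrix (Fin r) (Fin r) ℂ) - A))) *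
      (τ • (1 : Matrix (Fin r) (Fin r) ℂ) - A)⁻¹ := by rw [← e, Matrix.mul_one]
    _ = _ := by
      rw [Matrix.mul_smul, Matrix.smul_mul, Matrix.mul_sub, Matrix.sub_mul,
        Matrix.nonsing_inv_mul _ hθ, Matrix.one_mul,
        Matrix.mul_assoc, Matrix.mul_nonsing_inv _ hτ, Matrix.mul_one]

/-! ### Recovering a rational function from its Loewner data -/

namespace Loewner

variable {r m p : ℕ}

/-- The Loewner matrix of `F` at the points `θ` (left, direction `y`) and `τ` (right,
direction `x`). -/
noncomputable def loewner (τ θ : Fin r → ℂ) (x : Fin m → ℂ) (y : Fin p → ℂ) :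
    (ℂ → Matrix (Fin p) (Fin m) ℂ) →ₗ[ℂ] Matrix (Fin r) (Fin r) ℂ where
  toFun F := Matrix.of fun a b => (θ a - τ b)⁻¹ * (y ⬝ᵥ ((F (τ b) - F (θ a)) *ᵥ x))
  map_add' F G := by
    ext a b
    simp only [Pi.add_apply, Matrix.of_apply, Matrix.add_apply, Matrix.sub_mulVec,
      Matrix.add_mulVec, dotProduct_sub, dotProduct_add]
    ring
  map_smul' c F := by
    ext a b
    simp only [Pi.smul_apply, Matrix.of_apply, Matrix.smul_apply, Matrix.sub_mulVec,
      Matrix.smul_mulVec, dotProduct_sub, dotProduct_smul, smul_eq_mul, RingHom.id_apply]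
    ring

/-- The shifted Loewner matrix. -/
noncomputable def shifted (τ θ : Fin r → ℂ) (x : Fin m → ℂ) (y : Fin p → ℂ) :
    (ℂ → Matrix (Fin p) (Fin m) ℂ) →ₗ[ℂ] Matrix (Fin r) (Fin r) ℂ where
  toFun F := Matrix.of fun a b =>
    (θ a - τ b)⁻¹ * (y ⬝ᵥ ((τ b • F (τ b) - θ a • F (θ a)) *ᵥ x))
  map_add' F G := by
    ext a b
    simp only [Pi.add_apply, Matrix.of_apply, Matrix.add_apply, Matrix.sub_mulVec, smul_add,
      Matrix.add_mulVec, dotProduct_sub, dotProduct_add]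
    ring
  map_smul' c F := by
    ext a b
    simp only [Pi.smul_apply, Matrix.of_apply, Matrix.smul_apply, Matrix.sub_mulVec,
      Matrix.smul_mulVec, dotProduct_sub, dotProduct_smul, smul_eq_mul, RingHom.id_apply]
    ring

/-- The matrix pencil `s E - A` of the Loewner realization. -/
noncomputable def pencil (τ θ : Fin r → ℂ) (x : Fin m → ℂ) (y : Fin p → ℂ) (s : ℂ) :
    (ℂ → Matrix (Fin p) (Fin m) ℂ) →ₗ[ℂ] Matrix (Fin r) (Fin r) ℂ :=
  s • loewner τ θ x y - shifted τ θ x y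

/-- The values of `F` in the direction `x`, as columns. -/
noncomputable def rightData (τ : Fin r → ℂ) (x : Fin m → ℂ) :
    (ℂ → Matrix (Fin p) (Fin m) ℂ) →ₗ[ℂ] Matrix (Fin p) (Fin r) ℂ where
  toFun F := Matrix.of fun i b => (F (τ b) *ᵥ x) i
  map_add' F G := by ext i b; simp [Matrix.add_mulVec]
  map_smul' c F := by ext i b; simp [Matrix.smul_mulVec]

/-- The values of `F` in the direction `y`, as rows. -/
noncomputable def leftData (θ : Fin r → ℂ) (y : Fin p → ℂ) :
    (ℂ → Matrix (Fin p) (Fin m) ℂ) →ₗ[ℂ] Matrix (Fin r) (Fin m) ℂ where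
  toFun F := Matrix.of fun a j => (y ᵥ* F (θ a)) j
  map_add' F G := by ext i b; simp [Matrix.vecMul_add]
  map_smul' c F := by ext i b; simp [Matrix.vecMul_smul]

/-- The columns `(τ b - A)⁻¹ B x`. -/
noncomputable def reach (A : Matrix (Fin r) (Fin r) ℂ) (B : Matrix (Fin r) (Fin m) ℂ)
    (τ : Fin r → ℂ) (x : Fin m → ℂ) : Matrix (Fin r) (Fin r) ℂ :=
  Matrix.of fun k b => ((τ b • (1 : Matrix (Fin r) (Fin r) ℂ) - A)⁻¹ *ᵥ (B *ᵥ x)) k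

/-- The rows `y C (θ a - A)⁻¹`. -/
noncomputable def observe (A : Matrix (Fin r) (Fin r) ℂ) (C : Matrix (Fin p) (Fin r) ℂ)
    (θ : Fin r → ℂ) (y : Fin p → ℂ) : Matrix (Fin r) (Fin r) ℂ :=
  Matrix.of fun a k => ((y ᵥ* C) ᵥ* (θ a • (1 : Matrix (Fin r) (Fin r) ℂ) - A)⁻¹) k

/-- Only finitely many values of `F` enter, so the topology of pointwise convergence is enough, here
and for the other Loewner data. -/
theorem continuous_loewner (τ θ : Fin r → ℂ) (x : Fin m → ℂ) (y : Fin p → ℂ) :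
    Continuous (loewner τ θ x y) := by
  refine continuous_matrix fun a b => ?_
  simp only [loewner, LinearMap.coe_mk, AddHom.coe_mk, Matrix.of_apply]
  fun_prop

theorem continuous_shifted (τ θ : Fin r → ℂ) (x : Fin m → ℂ) (y : Fin p → ℂ) :
    Continuous (shifted τ θ x y) := by
  refine continuous_matrix fun a b => ?_
  simp only [shifted, LinearMap.coe_mk, AddHom.coe_mk, Matrix.of_apply]
  fun_prop

theorem pencil_apply (τ θ : Fin r → ℂ) (x : Fin m → ℂ) (y : Fin p → ℂ) (s : ℂ)
    (F : ℂ → Matrix (Fin p) (Fin m) ℂ) :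
    pencil τ θ x y s F = s • loewner τ θ x y F - shifted τ θ x y F := rfl

theorem continuous_pencil (τ θ : Fin r → ℂ) (x : Fin m → ℂ) (y : Fin p → ℂ) (s : ℂ) :
    Continuous (pencil τ θ x y s) :=
  ((continuous_loewner τ θ x y).const_smul s).sub (continuous_shifted τ θ x y)

theorem continuous_rightData (τ : Fin r → ℂ) (x : Fin m → ℂ) :
    Continuous (rightData (p := p) τ x) := by
  refine continuous_matrix fun i b => ?_
  simp only [rightData, LinearMap.coe_mk, AddHom.coe_mk, Matrix.of_apply, Matrix.mulVec, dotProduct]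
  fun_prop

theorem continuous_leftData (θ : Fin r → ℂ) (y : Fin p → ℂ) :
    Continuous (leftData (m := m) θ y) := by
  refine continuous_matrix fun i b => ?_
  simp only [leftData, LinearMap.coe_mk, AddHom.coe_mk, Matrix.of_apply, Matrix.vecMul, dotProduct]
  fun_prop

section Factor

variable {A : Matrix (Fin r) (Fin r) ℂ} {B : Matrix (Fin r) (Fin m) ℂ}
  {C : Matrix (Fin p) (Fin r) ℂ} {F : ℂ → Matrix (Fin p) (Fin m) ℂ} {τ θ : Fin r → ℂ}
  (x : Fin m → ℂ) (y : Fin p → ℂ)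

theorem rightData_eq (hτ : ∀ b, F (τ b) = transferFunction A B C (τ b)) :
    rightData τ x F = C * reach A B τ x := by
  ext i b
  simp only [rightData, LinearMap.coe_mk, AddHom.coe_mk, Matrix.of_apply, hτ, transferFunction]
  rw [← Matrix.mulVec_mulVec, ← Matrix.mulVec_mulVec]
  rfl

theorem leftData_eq (hθ : ∀ a, F (θ a) = transferFunction A B C (θ a)) :
    leftData θ y F = observe A C θ y * B := by
  ext a j
  simp only [leftData, LinearMap.coe_mk, AddHom.coe_mk, Matrix.of_apply, hθ, transferFunction]
  rw [← Matrix.vecMul_vecMul, ← Matrix.vecMul_vecMul]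
  rfl

theorem observe_mul_mul_reach_apply (X : Matrix (Fin r) (Fin r) ℂ) (a b : Fin r) :
    (observe A C θ y * X * reach A B τ x) a b =
      y ⬝ᵥ ((C * ((θ a • (1 : Matrix (Fin r) (Fin r) ℂ) - A)⁻¹ * X *
        (τ b • (1 : Matrix (Fin r) (Fin r) ℂ) - A)⁻¹) * B) *ᵥ x) := by
  have h : (observe A C θ y * X * reach A B τ x) a b =
      (((y ᵥ* C) ᵥ* (θ a • (1 : Matrix (Fin r) (Fin r) ℂ) - A)⁻¹) ᵥ* X) ⬝ᵥ
        ((τ b • (1 : Matrix (Fin r) (Fin r) ℂ) - A)⁻¹ *ᵥ (B *ᵥ x)) := rfl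
  rw [h]
  simp only [Matrix.dotProduct_mulVec, Matrix.vecMul_vecMul, Matrix.mul_assoc]

/-- By the resolvent identity, each divided difference of `C (s - A)⁻¹ B` is a product of a row `y C
(θ a - A)⁻¹` and a column `(τ b - A)⁻¹ B x`. -/
theorem loewner_eq (hτ : ∀ b, F (τ b) = transferFunction A B C (τ b))
    (hθ : ∀ a, F (θ a) = transferFunction A B C (θ a))
    (huτ : ∀ b, IsUnit (τ b • (1 : Matrix (Fin r) (Fin r) ℂ) - A))
    (huθ : ∀ a, IsUnit (θ a • (1 : Matrix (Fin r) (Fin r) ℂ) - A)) (hne : ∀ a b, θ a ≠ τ b) :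
    loewner τ θ x y F = observe A C θ y * reach A B τ x := by
  ext a b
  rw [← Matrix.mul_one (observe A C θ y), observe_mul_mul_reach_apply, Matrix.mul_one,
    resolvent_mul_resolvent (huθ a) (huτ b) (hne a b)]
  simp only [loewner, LinearMap.coe_mk, AddHom.coe_mk, Matrix.of_apply, hτ, hθ, transferFunction,
    Matrix.mul_smul, Matrix.smul_mul, Matrix.mul_sub, Matrix.sub_mul, Matrix.smul_mulVec,
    dotProduct_smul, smul_eq_mul]

theorem pencil_eq (hτ : ∀ b, F (τ b) = transferFunction A B C (τ b))
    (hθ : ∀ a, F (θ a) = transferFunction A B C (θ a))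
    (huτ : ∀ b, IsUnit (τ b • (1 : Matrix (Fin r) (Fin r) ℂ) - A))
    (huθ : ∀ a, IsUnit (θ a • (1 : Matrix (Fin r) (Fin r) ℂ) - A)) (hne : ∀ a b, θ a ≠ τ b)
    (s : ℂ) :
    pencil τ θ x y s F =
      observe A C θ y * (s • (1 : Matrix (Fin r) (Fin r) ℂ) - A) * reach A B τ x := by
  ext a b
  rw [observe_mul_mul_reach_apply, resolvent_mul_mul_resolvent (huθ a) (huτ b) (hne a b)]
  simp only [pencil_apply, loewner, shifted, LinearMap.coe_mk, AddHom.coe_mk, Matrix.of_apply, hτ,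
    hθ, transferFunction, Matrix.mul_smul, Matrix.smul_mul, Matrix.mul_sub, Matrix.sub_mul,
    Matrix.smul_mulVec, dotProduct_smul, smul_eq_mul, Matrix.sub_apply, Matrix.smul_apply,
    Matrix.sub_mulVec, dotProduct_sub]
  ring

/-- A rational function of order at most `r` is recovered from its Loewner data as soon as the
`r × r` Loewner matrix is invertible. -/
theorem isUnit_pencil_and_eq (hτ : ∀ b, F (τ b) = transferFunction A B C (τ b))
    (hθ : ∀ a, F (θ a) = transferFunction A B C (θ a))
    (huτ : ∀ b, IsUnit (τ b • (1 : Matrix (Fin r) (Fin r) ℂ) - A))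
    (huθ : ∀ a, IsUnit (θ a • (1 : Matrix (Fin r) (Fin r) ℂ) - A)) (hne : ∀ a b, θ a ≠ τ b)
    (hL : (loewner τ θ x y F).det ≠ 0) {s : ℂ} (hs : F s = transferFunction A B C s)
    (hus : IsUnit (s • (1 : Matrix (Fin r) (Fin r) ℂ) - A)) :
    (pencil τ θ x y s F).det ≠ 0 ∧
      F s = rightData τ x F * (pencil τ θ x y s F)⁻¹ * leftData θ y F := by
  rw [loewner_eq x y hτ hθ huτ huθ hne, Matrix.det_mul] at hL
  rw [pencil_eq x y hτ hθ huτ huθ hne, rightData_eq x hτ, leftData_eq y hθ, hs]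
  -- Both factors are square because the number of samples on each side equals the order `r`; so
  -- both are invertible and act as changes of coordinates.
  have hO : IsUnit (observe A C θ y).det := isUnit_iff_ne_zero.2 (left_ne_zero_of_mul hL)
  have hR : IsUnit (reach A B τ x).det := isUnit_iff_ne_zero.2 (right_ne_zero_of_mul hL)
  rw [Matrix.isUnit_iff_isUnit_det] at hus
  refine ⟨?_, ?_⟩
  · rw [Matrix.det_mul, Matrix.det_mul]
    exact mul_ne_zero (mul_ne_zero hO.ne_zero hus.ne_zero) hR.ne_zero
  · rw [Matrix.mul_inv_rev, Matrix.mul_inv_rev, transferFunction]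
    have h1 := Matrix.mul_nonsing_inv_cancel_left (reach A B τ x)
      ((s • (1 : Matrix (Fin r) (Fin r) ℂ) - A)⁻¹ * B) hR
    have h2 := Matrix.nonsing_inv_mul_cancel_left (observe A C θ y) B hO
    simp only [Matrix.mul_assoc]
    rw [h2, h1]

end Factor

/-! ### Differentiating the Loewner formula -/

theorem tendsto_matrix_inv {ι : Type*} {l : Filter ι} {Q : ι → Matrix (Fin r) (Fin r) ℂ}
    {Q₀ : Matrix (Fin r) (Fin r) ℂ} (h : Tendsto Q l (𝓝 Q₀)) (h0 : Q₀.det ≠ 0) :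
    Tendsto (fun t => (Q t)⁻¹) l (𝓝 Q₀⁻¹) := by
  refine (continuousAt_matrix_inv Q₀ ?_).tendsto.comp h
  rw [Ring.inverse_eq_inv']
  exact continuousAt_inv₀ h0

theorem tendsto_matrix_mul {ι : Type*} {l : Filter ι} {k n q : ℕ}
    {f : ι → Matrix (Fin k) (Fin n) ℂ} {g : ι → Matrix (Fin n) (Fin q) ℂ}
    {f₀ : Matrix (Fin k) (Fin n) ℂ} {g₀ : Matrix (Fin n) (Fin q) ℂ}
    (hf : Tendsto f l (𝓝 f₀)) (hg : Tendsto g l (𝓝 g₀)) :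
    Tendsto (fun t => f t * g t) l (𝓝 (f₀ * g₀)) := by
  refine tendsto_pi_nhds.2 fun i => tendsto_pi_nhds.2 fun j => ?_
  simp only [Matrix.mul_apply]
  exact tendsto_finsetSum _ fun l _ => (tendsto_pi_nhds.1 (tendsto_pi_nhds.1 hf i) l).mul
    (tendsto_pi_nhds.1 (tendsto_pi_nhds.1 hg l) j)

/-- The product rule before the limit: each summand contains exactly one increment. -/
theorem difference_eq {W W₀ : Matrix (Fin p) (Fin r) ℂ} {V V₀ : Matrix (Fin r) (Fin m) ℂ}
    {Q Q₀ : Matrix (Fin r) (Fin r) ℂ} (hQ : Q.det ≠ 0) (hQ₀ : Q₀.det ≠ 0) :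
    W * Q⁻¹ * V - W₀ * Q₀⁻¹ * V₀ =
      (W - W₀) * Q₀⁻¹ * V₀ + W * Q⁻¹ * (V - V₀) - W * Q⁻¹ * (Q - Q₀) * Q₀⁻¹ * V₀ := by
  have h1 : W * Q⁻¹ * Q = W := Matrix.nonsing_inv_mul_cancel_right _ _ (isUnit_iff_ne_zero.2 hQ)
  have h2 : W * Q⁻¹ * Q₀ * Q₀⁻¹ = W * Q⁻¹ :=
    Matrix.mul_nonsing_inv_cancel_right _ _ (isUnit_iff_ne_zero.2 hQ₀)
  rw [Matrix.mul_sub (W * Q⁻¹) Q Q₀, h1, Matrix.sub_mul W (W * Q⁻¹ * Q₀), h2]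
  simp only [Matrix.sub_mul, Matrix.mul_sub]
  abel

/-- The velocity of a curve of stable rational functions of order `r`, in terms of a realization at
time `0` with an invertible Loewner matrix. -/
theorem velocity_eq {F : ℝ → ℂ → Matrix (Fin p) (Fin m) ℂ} {v : ℂ → Matrix (Fin p) (Fin m) ℂ}
    (hF : ∀ᶠ t in 𝓝 (0 : ℝ), ∃ (A : Matrix (Fin r) (Fin r) ℂ) (B : Matrix (Fin r) (Fin m) ℂ)
      (C : Matrix (Fin p) (Fin r) ℂ), IsHurwitz A ∧
        ∀ s : ℂ, 0 < s.re → F t s = transferFunction A B C s)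
    (hder : ∀ s i j, HasDerivAt (fun t => F t s i j) (v s i j) 0)
    {A : Matrix (Fin r) (Fin r) ℂ} {B : Matrix (Fin r) (Fin m) ℂ}
    {C : Matrix (Fin p) (Fin r) ℂ} (hA : IsHurwitz A)
    (hF0 : ∀ s : ℂ, 0 < s.re → F 0 s = transferFunction A B C s)
    {τ θ : Fin r → ℂ} {x : Fin m → ℂ} {y : Fin p → ℂ} (hτ : ∀ b, 0 < (τ b).re)
    (hθ : ∀ a, 0 < (θ a).re) (hne : ∀ a b, θ a ≠ τ b)
    (hO : (observe A C θ y).det ≠ 0) (hR : (reach A B τ x).det ≠ 0) :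
    ∃ (P : Matrix (Fin p) (Fin r) ℂ) (S : Matrix (Fin r) (Fin m) ℂ) (Z : Matrix (Fin r) (Fin r) ℂ),
      ∀ s : ℂ, 0 < s.re → v s = P * (s • (1 : Matrix (Fin r) (Fin r) ℂ) - A)⁻¹ * B +
        C * (s • (1 : Matrix (Fin r) (Fin r) ℂ) - A)⁻¹ * S +
        C * (s • (1 : Matrix (Fin r) (Fin r) ℂ) - A)⁻¹ * Z *
          (s • (1 : Matrix (Fin r) (Fin r) ℂ) - A)⁻¹ * B := by
  have hL : (loewner τ θ x y (F 0)).det ≠ 0 := by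
    rw [loewner_eq x y (fun b => hF0 _ (hτ b)) (fun a => hF0 _ (hθ a))
      (fun b => hA.isUnit (hτ b).le) (fun a => hA.isUnit (hθ a).le) hne, Matrix.det_mul]
    exact mul_ne_zero hO hR
  have hcont : Tendsto F (𝓝 0) (𝓝 (F 0)) := by
    refine tendsto_pi_nhds.2 fun s => tendsto_pi_nhds.2 fun i => tendsto_pi_nhds.2 fun j => ?_
    exact (hder s i j).continuousAt.tendsto
  have hslope : Tendsto (fun t : ℝ => ((t : ℂ)⁻¹) • (F t - F 0)) (𝓝[≠] 0) (𝓝 v) := by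
    refine tendsto_pi_nhds.2 fun s => tendsto_pi_nhds.2 fun i => tendsto_pi_nhds.2 fun j => ?_
    have := hasDerivAt_iff_tendsto_slope_zero.1 (hder s i j)
    refine this.congr fun t => ?_
    simp
  have hev : ∀ᶠ t in 𝓝 (0 : ℝ), (loewner τ θ x y (F t)).det ≠ 0 :=
    (((continuous_loewner τ θ x y).matrix_det.tendsto (F 0)).comp hcont).eventually_ne hL
  set O := observe A C θ y
  set R := reach A B τ x
  set X := O⁻¹ * loewner τ θ x y v * R⁻¹ with hX
  set Y := O⁻¹ * shifted τ θ x y v * R⁻¹ with hY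
  -- These are read off from the differentiated formula: the pencil of `v`, in the coordinates of
  -- `O` and `R`, is `s X - Y = (s - A) X - (Y - A X)`. The first part cancels a resolvent and joins
  -- `P`; the second is free of `s` and becomes `Z`.
  refine ⟨rightData τ x v * R⁻¹ - C * X, O⁻¹ * leftData θ y v, Y - A * X, fun s hs => ?_⟩
  set T := s • (1 : Matrix (Fin r) (Fin r) ℂ) - A with hT
  have hTu : IsUnit T.det := (Matrix.isUnit_iff_isUnit_det _).1 (hA.isUnit hs.le)
  obtain ⟨hQ₀, hFs⟩ := isUnit_pencil_and_eq x y (fun b => hF0 _ (hτ b)) (fun a => hF0 _ (hθ a))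
    (fun b => hA.isUnit (hτ b).le) (fun a => hA.isUnit (hθ a).le) hne hL (hF0 s hs)
    (hA.isUnit hs.le)
  have hlim : v s = rightData τ x v * (pencil τ θ x y s (F 0))⁻¹ * leftData θ y (F 0) +
      rightData τ x (F 0) * (pencil τ θ x y s (F 0))⁻¹ * leftData θ y v -
      rightData τ x (F 0) * (pencil τ θ x y s (F 0))⁻¹ * pencil τ θ x y s v *
        (pencil τ θ x y s (F 0))⁻¹ * leftData θ y (F 0) := by
    have hc' := hcont.mono_left (nhdsWithin_le_nhds (s := {0}ᶜ))
    have hQ := tendsto_matrix_inv (((continuous_pencil τ θ x y s).tendsto (F 0)).comp hc') hQ₀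
    have hW := ((continuous_rightData τ x).tendsto (F 0)).comp hc'
    have hWQ := tendsto_matrix_mul hW hQ
    have hWd := ((continuous_rightData τ x).tendsto v).comp hslope
    have hVd := ((continuous_leftData θ y).tendsto v).comp hslope
    have hQd := ((continuous_pencil τ θ x y s).tendsto v).comp hslope
    have hrhs := ((tendsto_matrix_mul (tendsto_matrix_mul hWd
      (tendsto_const_nhds (x := (pencil τ θ x y s (F 0))⁻¹)))
      (tendsto_const_nhds (x := leftData θ y (F 0)))).add (tendsto_matrix_mul hWQ hVd)).sub (tendsto_matrix_mul
        (tendsto_matrix_mul (tendsto_matrix_mul hWQ hQd)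
          (tendsto_const_nhds (x := (pencil τ θ x y s (F 0))⁻¹)))
        (tendsto_const_nhds (x := leftData θ y (F 0))))
    refine tendsto_nhds_unique (tendsto_pi_nhds.1 hslope s) (hrhs.congr' ?_)
    filter_upwards [hF.filter_mono nhdsWithin_le_nhds, hev.filter_mono nhdsWithin_le_nhds]
      with t ht hdet
    -- This realization may vary arbitrarily with `t`; it only certifies the Loewner formula at time
    -- `t` and then disappears.
    obtain ⟨A', B', C', hA', hFt⟩ := ht
    obtain ⟨hQt, hFts⟩ := isUnit_pencil_and_eq x y (fun b => hFt _ (hτ b))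
      (fun a => hFt _ (hθ a)) (fun b => hA'.isUnit (hτ b).le) (fun a => hA'.isUnit (hθ a).le) hne
      hdet (hFt s hs) (hA'.isUnit hs.le)
    simp only [Function.comp_apply, Pi.smul_apply, Pi.sub_apply, map_smul, map_sub]
    rw [hFts, hFs, difference_eq hQt hQ₀]
    simp only [Matrix.smul_mul, Matrix.mul_smul, ← smul_sub, ← smul_add]
  have hO' : IsUnit O.det := isUnit_iff_ne_zero.2 hO
  have hR' : IsUnit R.det := isUnit_iff_ne_zero.2 hR
  have hsplit : O⁻¹ * pencil τ θ x y s v * R⁻¹ = T * X - (Y - A * X) := by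
    rw [pencil_apply, hX, hY, hT]
    simp only [Matrix.mul_sub, Matrix.sub_mul, Matrix.mul_smul, Matrix.smul_mul, Matrix.one_mul]
    abel
  have h1 : ∀ K : Matrix (Fin p) (Fin r) ℂ, K * (O * T * R)⁻¹ * (O * B) = K * R⁻¹ * T⁻¹ * B := by
    intro K
    rw [Matrix.mul_inv_rev, Matrix.mul_inv_rev]
    simp only [Matrix.mul_assoc]
    rw [Matrix.nonsing_inv_mul_cancel_left _ _ hO']
  have h2 : C * R * (O * T * R)⁻¹ = C * T⁻¹ * O⁻¹ := by
    rw [Matrix.mul_inv_rev, Matrix.mul_inv_rev]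
    simp only [Matrix.mul_assoc]
    rw [Matrix.mul_nonsing_inv_cancel_left _ _ hR']
  have h3 : C * T⁻¹ * O⁻¹ * pencil τ θ x y s v * R⁻¹ =
      C * T⁻¹ * (O⁻¹ * pencil τ θ x y s v * R⁻¹) := by simp only [Matrix.mul_assoc]
  have h4 : C * T⁻¹ * (T * X) = C * X := by
    rw [Matrix.mul_assoc, Matrix.nonsing_inv_mul_cancel_left _ _ hTu]
  rw [hlim, pencil_eq x y (fun b => hF0 _ (hτ b)) (fun a => hF0 _ (hθ a))
    (fun b => hA.isUnit (hτ b).le) (fun a => hA.isUnit (hθ a).le) hne,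
    rightData_eq x (fun b => hF0 _ (hτ b)), leftData_eq y (fun a => hF0 _ (hθ a)),
    h1, h1, h2, h3, hsplit, Matrix.mul_sub, h4]
  simp only [Matrix.sub_mul, Matrix.mul_assoc]
  abel

end Loewner

/-! ### Pole-residue data of a minimal rational function -/

theorem differentiableOn_det {n : ℕ} {U : Set ℂ} {M : ℂ → Matrix (Fin n) (Fin n) ℂ}
    (hM : ∀ i j, DifferentiableOn ℂ (fun s => M s i j) U) :
    DifferentiableOn ℂ (fun s => (M s).det) U := by
  simp only [Matrix.det_apply']
  refine DifferentiableOn.fun_sum fun σ _ => DifferentiableOn.const_mul ?_ _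
  exact DifferentiableOn.fun_finsetProd fun i _ => hM _ _

theorem differentiableOn_transferFunction {r m p : ℕ} (A : Matrix (Fin r) (Fin r) ℂ)
    (B : Matrix (Fin r) (Fin m) ℂ) (C : Matrix (Fin p) (Fin r) ℂ) (i : Fin p) (j : Fin m) :
    DifferentiableOn ℂ (fun s => transferFunction A B C s i j) (spectrum ℂ A)ᶜ := by
  have hent : ∀ a b, DifferentiableOn ℂ
      (fun s : ℂ => (s • (1 : Matrix (Fin r) (Fin r) ℂ) - A) a b) (spectrum ℂ A)ᶜ := by
    intro a b
    simp only [Matrix.sub_apply, Matrix.smul_apply, smul_eq_mul]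
    fun_prop
  have hinv : ∀ a b, DifferentiableOn ℂ
      (fun s : ℂ => (s • (1 : Matrix (Fin r) (Fin r) ℂ) - A)⁻¹ a b) (spectrum ℂ A)ᶜ := by
    intro a b
    simp only [Matrix.inv_def, Ring.inverse_eq_inv', Matrix.smul_apply, smul_eq_mul,
      Matrix.adjugate_apply]
    refine DifferentiableOn.mul (DifferentiableOn.inv (differentiableOn_det hent) fun s hs => ?_)
      (differentiableOn_det fun k l => ?_)
    · exact ((Matrix.isUnit_iff_isUnit_det _).1 (isUnit_smul_one_sub hs)).ne_zero
    · by_cases hk : k = b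
      · subst hk
        simp only [Matrix.updateRow_self]
        exact differentiableOn_const _
      · simp only [Matrix.updateRow_ne hk]
        exact hent k l
  simp only [transferFunction, Matrix.mul_apply]
  exact DifferentiableOn.fun_sum fun k _ => DifferentiableOn.mul_const
    (DifferentiableOn.fun_sum fun l _ => DifferentiableOn.const_mul (hinv l k) _) _

theorem resolvent_diagonal {r : ℕ} {lam : Fin r → ℂ} {s : ℂ} (hs : ∀ i, s ≠ lam i) :
    (s • (1 : Matrix (Fin r) (Fin r) ℂ) - Matrix.diagonal lam)⁻¹ =
      Matrix.diagonal fun i => (s - lam i)⁻¹ := by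
  refine Matrix.inv_eq_left_inv ?_
  have e : s • (1 : Matrix (Fin r) (Fin r) ℂ) - Matrix.diagonal lam =
      Matrix.diagonal fun i => s - lam i := by
    rw [← Matrix.diagonal_one, ← Matrix.diagonal_smul, Matrix.diagonal_sub]
    simp
  rw [e, Matrix.diagonal_mul_diagonal, ← Matrix.diagonal_one]
  congr 1
  ext i
  exact inv_mul_cancel₀ (sub_ne_zero.2 (hs i))

theorem mul_diagonal_mul_eq_sum {r m p : ℕ} (d : Fin r → ℂ) (B : Matrix (Fin r) (Fin m) ℂ)
    (C : Matrix (Fin p) (Fin r) ℂ) :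
    C * Matrix.diagonal d * B = ∑ i, d i • Matrix.vecMulVec (C.col i) (B.row i) := by
  ext k l
  rw [Matrix.mul_apply]
  simp only [Matrix.mul_diagonal, Matrix.sum_apply, Matrix.smul_apply,
    Matrix.vecMulVec_apply, smul_eq_mul, Matrix.col_apply, Matrix.row_apply]
  exact Finset.sum_congr rfl fun i _ => by ring

theorem transferFunction_diagonal {r m p : ℕ} {lam : Fin r → ℂ} {s : ℂ} (hs : ∀ i, s ≠ lam i)
    (B : Matrix (Fin r) (Fin m) ℂ) (C : Matrix (Fin p) (Fin r) ℂ) :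
    transferFunction (Matrix.diagonal lam) B C s =
      ∑ i, (s - lam i)⁻¹ • Matrix.vecMulVec (C.col i) (B.row i) := by
  rw [transferFunction, resolvent_diagonal hs, mul_diagonal_mul_eq_sum]

/-- Two descriptions of a rational function that agree near a point agree wherever both make
sense. -/
theorem transferFunction_eq_of_eventuallyEq {r m p r' : ℕ} (A : Matrix (Fin r) (Fin r) ℂ)
    (B : Matrix (Fin r) (Fin m) ℂ) (C : Matrix (Fin p) (Fin r) ℂ)
    (A' : Matrix (Fin r') (Fin r') ℂ) (B' : Matrix (Fin r') (Fin m) ℂ)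
    (C' : Matrix (Fin p) (Fin r') ℂ) {z : ℂ} (hz : z ∉ spectrum ℂ A) (hz' : z ∉ spectrum ℂ A')
    (h : ∀ᶠ s in 𝓝 z, transferFunction A B C s = transferFunction A' B' C' s) {s : ℂ}
    (hs : s ∉ spectrum ℂ A) (hs' : s ∉ spectrum ℂ A') :
    transferFunction A B C s = transferFunction A' B' C' s := by
  have hfin : (spectrum ℂ A ∪ spectrum ℂ A').Finite :=
    (Matrix.finite_spectrum A).union (Matrix.finite_spectrum A')
  have hopen : IsOpen (spectrum ℂ A ∪ spectrum ℂ A')ᶜ := hfin.isClosed.isOpen_compl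
  have hconn : IsPreconnected (spectrum ℂ A ∪ spectrum ℂ A')ᶜ :=
    (hfin.countable.isConnected_compl_of_one_lt_rank (by simp)).isPreconnected
  ext i j
  have hf := ((differentiableOn_transferFunction A B C i j).mono
    (Set.compl_subset_compl.2 Set.subset_union_left)).analyticOnNhd hopen
  have hg := ((differentiableOn_transferFunction A' B' C' i j).mono
    (Set.compl_subset_compl.2 Set.subset_union_right)).analyticOnNhd hopen
  refine hf.eqOn_of_preconnected_of_eventuallyEq hg hconn (z₀ := z) (by simp [hz, hz']) ?_
    (by simp [hs, hs'])
  filter_upwards [h] with s hs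
  rw [hs]

section PoleResidue

variable {r m p : ℕ} {A : Matrix (Fin r) (Fin r) ℂ} {B : Matrix (Fin r) (Fin m) ℂ}
  {C : Matrix (Fin p) (Fin r) ℂ} {lam : Fin r → ℂ} {b : Fin r → Fin m → ℂ}
  {c : Fin r → Fin p → ℂ}

/-- A zero residue could be dropped, leaving a diagonal realization of order `r - 1`, against
minimality. -/
theorem residue_ne_zero (hA : IsHurwitz A) (hmin : IsMinimalRealization A B C)
    (hres : ∀ s : ℂ, 0 < s.re → (∀ i, s ≠ lam i) →
      transferFunction A B C s = ∑ i, (s - lam i)⁻¹ • Matrix.vecMulVec (c i) (star (b i)))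
    (i : Fin r) : Matrix.vecMulVec (c i) (star (b i)) ≠ 0 := by
  intro h0
  obtain ⟨n, rfl⟩ : ∃ n, r = n + 1 := Nat.exists_eq_succ_of_ne_zero (by rintro rfl; exact i.elim0)
  set μ : Fin n → ℂ := fun j => lam (i.succAbove j) with hμ
  -- A point of the right half-plane away from all `lam j`, which are not yet known to be stable;
  -- the identity theorem spreads the agreement near `z`.
  set z : ℂ := ((1 + ∑ j, ‖lam j‖ : ℝ) : ℂ) with hz
  have hzre : 0 < z.re := by
    rw [hz, ofReal_re]
    have : 0 ≤ ∑ j, ‖lam j‖ := Finset.sum_nonneg fun _ _ => norm_nonneg _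
    linarith
  have hzlam : ∀ j, z ≠ lam j := by
    intro j h
    have h1 : ‖lam j‖ ≤ ∑ j, ‖lam j‖ :=
      Finset.single_le_sum (fun _ _ => norm_nonneg _) (Finset.mem_univ j)
    have h2 := re_le_norm (lam j)
    rw [← h, hz, ofReal_re, ← hz, h] at h2
    linarith
  have hzμ : z ∉ spectrum ℂ (Matrix.diagonal μ) := by
    rw [spectrum_diagonal]
    rintro ⟨j, hj⟩
    exact hzlam _ hj.symm
  have hev : ∀ᶠ s in 𝓝 z, transferFunction A B C s =
      transferFunction (Matrix.diagonal μ) (Matrix.of fun j => star (b (i.succAbove j)))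
        (Matrix.of fun k j => c (i.succAbove j) k) s := by
    have h1 : ∀ᶠ s : ℂ in 𝓝 z, ∀ j, s ≠ lam j :=
      eventually_all.2 fun j => isOpen_ne.mem_nhds (hzlam j)
    have h2 : ∀ᶠ s : ℂ in 𝓝 z, 0 < s.re :=
      (isOpen_lt continuous_const continuous_re).mem_nhds hzre
    filter_upwards [h1, h2] with s hs1 hs2
    rw [hres s hs2 hs1, transferFunction_diagonal (fun j => hs1 _), Fin.sum_univ_succAbove _ i, h0,
      smul_zero, zero_add]
    rfl
  have := hmin n (Matrix.diagonal μ) _ _ fun s hs hs' =>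
    transferFunction_eq_of_eventuallyEq A B C _ _ _ (hA.notMem_spectrum hzre.le) hzμ hev hs hs'
  omega

/-- If `Re (lam i) ≥ 0`, then `C (s - A)⁻¹ B` is continuous at `lam i`, so the residue there
vanishes. The approach along `lam i + ε` stays in the open half-plane even when `lam i` is on the
axis. -/
theorem pole_re_neg (hA : IsHurwitz A) (hdist : Function.Injective lam)
    (hres : ∀ s : ℂ, 0 < s.re → (∀ i, s ≠ lam i) →
      transferFunction A B C s = ∑ i, (s - lam i)⁻¹ • Matrix.vecMulVec (c i) (star (b i)))
    {i : Fin r} (hi : Matrix.vecMulVec (c i) (star (b i)) ≠ 0) : (lam i).re < 0 := by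
  by_contra! hre
  apply hi
  ext k l
  have hsp := hA.notMem_spectrum hre
  have hpath : Tendsto (fun ε : ℝ => lam i + (ε : ℂ)) (𝓝[>] 0) (𝓝 (lam i)) := by
    have : Continuous fun u : ℝ => lam i + (u : ℂ) := by fun_prop
    simpa using (this.tendsto 0).mono_left nhdsWithin_le_nhds
  have hε : Tendsto (fun ε : ℝ => (ε : ℂ)) (𝓝[>] 0) (𝓝 0) := by
    simpa using (continuous_ofReal.tendsto 0).mono_left nhdsWithin_le_nhds
  have hcont : ContinuousAt (fun s => transferFunction A B C s k l) (lam i) :=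
    (differentiableOn_transferFunction A B C k l).continuousOn.continuousAt
      ((Matrix.finite_spectrum A).isClosed.isOpen_compl.mem_nhds hsp)
  have h1 : Tendsto (fun ε : ℝ => (ε : ℂ) * transferFunction A B C (lam i + ε) k l) (𝓝[>] 0)
      (𝓝 0) := by
    simpa using hε.mul (hcont.tendsto.comp hpath)
  have h2 : Tendsto (fun ε : ℝ => ∑ j, ((ε : ℂ) * (lam i + ε - lam j)⁻¹) *
      Matrix.vecMulVec (c j) (star (b j)) k l) (𝓝[>] 0)
      (𝓝 (∑ j, (if j = i then 1 else 0) * Matrix.vecMulVec (c j) (star (b j)) k l)) := by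
    refine tendsto_finsetSum _ fun j _ => Tendsto.mul_const _ ?_
    by_cases hj : j = i
    · subst hj
      rw [if_pos rfl]
      refine tendsto_const_nhds.congr' ?_
      filter_upwards [self_mem_nhdsWithin] with ε hε'
      have : (ε : ℂ) ≠ 0 := ofReal_ne_zero.2 (ne_of_gt hε')
      rw [add_sub_cancel_left, mul_inv_cancel₀ this]
    · rw [if_neg hj]
      have hne : lam i - lam j ≠ 0 := sub_ne_zero.2 fun h => hj (hdist h).symm
      simpa using hε.mul ((hpath.sub_const (lam j)).inv₀ hne)
  simp only [ite_mul, one_mul, zero_mul, Finset.sum_ite_eq', Finset.mem_univ, if_true] at h2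
  refine tendsto_nhds_unique h2 (h1.congr' ?_)
  have h3 : ∀ᶠ ε : ℝ in 𝓝[>] 0, ∀ j, lam i + (ε : ℂ) ≠ lam j := by
    refine eventually_all.2 fun j => ?_
    by_cases hj : j = i
    · subst hj
      filter_upwards [self_mem_nhdsWithin] with ε hε' h
      exact (ne_of_gt hε' : ε ≠ 0) (by simpa using h)
    · exact hpath.eventually_ne fun h => hj (hdist h).symm
  filter_upwards [h3, self_mem_nhdsWithin] with ε hne hε'
  have hε0 : 0 < ε := hε'
  rw [hres (lam i + ε) (by simp; linarith) hne, Matrix.sum_apply, Finset.mul_sum]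
  refine Finset.sum_congr rfl fun j _ => ?_
  rw [Matrix.smul_apply, smul_eq_mul, mul_assoc]

end PoleResidue

/-! ### Invertible Loewner data for a diagonal realization -/

/-- The Cauchy matrix `1 / (τ b - lam k)` has independent rows. -/
theorem eq_zero_of_sum_mul_inv_sub_eq_zero {r : ℕ} {lam τ : Fin r → ℂ}
    (hlam : Function.Injective lam) (hτ : Function.Injective τ) (hne : ∀ b k, τ b ≠ lam k)
    {w : Fin r → ℂ} (h : ∀ b, ∑ k, w k * (τ b - lam k)⁻¹ = 0) (k : Fin r) : w k = 0 := by
  classical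
  -- The numerator after clearing denominators: degree at most `r - 1`, but `r` distinct zeros `τ
  -- b`. Its value at `lam k` is `w k` times a nonzero product.
  set P : Polynomial ℂ := ∑ k, Polynomial.C (w k) *
    ∏ j ∈ Finset.univ.erase k, (Polynomial.X - Polynomial.C (lam j)) with hP
  have hev : ∀ t, P.eval t = ∑ k, w k * ∏ j ∈ Finset.univ.erase k, (t - lam j) := by
    intro t
    simp [hP, Polynomial.eval_finsetSum, Polynomial.eval_prod]
  have hdeg : P.natDegree < Fintype.card (Fin r) := by
    rw [Fintype.card_fin]
    have h1 : P.natDegree ≤ r - 1 := by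
      refine Polynomial.natDegree_sum_le_of_forall_le _ _ fun k _ => ?_
      refine (Polynomial.natDegree_C_mul_le _ _).trans ?_
      rw [Polynomial.natDegree_prod_of_monic _ _ fun j _ => Polynomial.monic_X_sub_C _]
      simp [Finset.card_erase_of_mem]
    have := k.pos
    omega
  have hzero : P = 0 := by
    refine Polynomial.eq_zero_of_natDegree_lt_card_of_eval_eq_zero P hτ (fun a => ?_) hdeg
    rw [hev]
    have h2 : ∀ k, w k * ∏ j ∈ Finset.univ.erase k, (τ a - lam j) =
        (∏ j, (τ a - lam j)) * (w k * (τ a - lam k)⁻¹) := by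
      intro k
      rw [← Finset.mul_prod_erase _ _ (Finset.mem_univ k)]
      have := sub_ne_zero.2 (hne a k)
      field_simp
    simp only [h2]
    rw [← Finset.mul_sum, h a, mul_zero]
  have h3 := hev (lam k)
  rw [hzero, Polynomial.eval_zero, Finset.sum_eq_single k] at h3
  · refine (mul_eq_zero.1 h3.symm).resolve_right (Finset.prod_ne_zero_iff.2 fun j hj => ?_)
    exact sub_ne_zero.2 fun h => (Finset.ne_of_mem_erase hj) (hlam h).symm
  · intro j _ hj
    rw [Finset.prod_eq_zero (Finset.mem_erase.2 ⟨hj.symm, Finset.mem_univ k⟩) (sub_self _),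
      mul_zero]
  · simp

/-- Finitely many hyperplanes do not cover a vector space over an infinite field. -/
theorem exists_forall_dotProduct_ne_zero {r m : ℕ} {B : Fin r → Fin m → ℂ} (hB : ∀ i, B i ≠ 0) :
    ∃ x : Fin m → ℂ, ∀ i, B i ⬝ᵥ x ≠ 0 := by
  refine Module.Dual.exists_forall_ne_zero_of_forall_exists
    (fun i => (LinearMap.proj i).comp (Matrix.mulVecLin (Matrix.of B))) fun i => ?_
  obtain ⟨j, hj⟩ := Function.ne_iff.1 (hB i)
  refine ⟨Pi.single j 1, ?_⟩
  simpa using hj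

namespace Loewner

/-- For diagonal `A` this matrix is a Cauchy matrix with row `k` scaled by `B k ⬝ᵥ x`. -/
theorem det_reach_diagonal_ne_zero {r m : ℕ} {lam τ : Fin r → ℂ} (hlam : Function.Injective lam)
    (hτ : Function.Injective τ) (hne : ∀ b k, τ b ≠ lam k) {B : Matrix (Fin r) (Fin m) ℂ}
    {x : Fin m → ℂ} (hx : ∀ i, B i ⬝ᵥ x ≠ 0) :
    (reach (Matrix.diagonal lam) B τ x).det ≠ 0 := by
  intro h0
  obtain ⟨v, hv, hv0⟩ := Matrix.exists_vecMul_eq_zero_iff.2 h0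
  apply hv
  ext k
  have hw := eq_zero_of_sum_mul_inv_sub_eq_zero hlam hτ hne (w := fun k => v k * (B k ⬝ᵥ x))
    (fun a => by
      have := congrFun hv0 a
      rw [Pi.zero_apply] at this
      rw [← this]
      simp only [Matrix.vecMul, dotProduct, reach, Matrix.of_apply, resolvent_diagonal (hne a),
        Matrix.mulVec_diagonal]
      refine Finset.sum_congr rfl fun k _ => ?_
      simp only [Matrix.mulVec, dotProduct]
      ring) k
  exact (mul_eq_zero.1 hw).resolve_right (hx k)

theorem det_observe_diagonal_ne_zero {r p : ℕ} {lam θ : Fin r → ℂ} (hlam : Function.Injective lam)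
    (hθ : Function.Injective θ) (hne : ∀ b k, θ b ≠ lam k) {C : Matrix (Fin p) (Fin r) ℂ}
    {y : Fin p → ℂ} (hy : ∀ i, C.col i ⬝ᵥ y ≠ 0) :
    (observe (Matrix.diagonal lam) C θ y).det ≠ 0 := by
  intro h0
  obtain ⟨v, hv, hv0⟩ := Matrix.exists_mulVec_eq_zero_iff.2 h0
  apply hv
  ext k
  have hw := eq_zero_of_sum_mul_inv_sub_eq_zero hlam hθ hne (w := fun k => v k * (C.col k ⬝ᵥ y))
    (fun a => by
      have := congrFun hv0 a
      rw [Pi.zero_apply] at this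
      rw [← this]
      simp only [Matrix.mulVec, dotProduct, observe, Matrix.of_apply, resolvent_diagonal (hne a),
        Matrix.vecMul_diagonal]
      refine Finset.sum_congr rfl fun k _ => ?_
      simp only [Matrix.vecMul, dotProduct, Matrix.col_apply, mul_comm (C _ k)]
      ring) k
  exact (mul_eq_zero.1 hw).resolve_right (hy k)

end Loewner

/-! ### Tangent vectors and the orthogonality relations -/

namespace Hardy

variable {p m : ℕ}

/-- Evaluation at a point as a linear map. -/
noncomputable def evalₗ (s : ℂ) : Hardy p m →ₗ[ℂ] Matrix (Fin p) (Fin m) ℂ where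
  toFun F := F s
  map_add' _ _ := rfl
  map_smul' _ _ := rfl

theorem evalₗ_apply (s : ℂ) (F : Hardy p m) : evalₗ s F = F s := rfl

theorem apply_eq_zero (F : Hardy p m) {s : ℂ} (hs : s.re ≤ 0) : F s = 0 := F.2.2.2 s hs

theorem ext_of_re_pos {F G : Hardy p m} (h : ∀ s : ℂ, 0 < s.re → F s = G s) : F = G := by
  apply Subtype.ext
  funext s
  rcases le_or_gt s.re 0 with hs | hs
  · exact (F.apply_eq_zero hs).trans (G.apply_eq_zero hs).symm
  · exact h s hs

theorem derivative_sub (F G : Hardy p m) {s : ℂ} (hs : 0 < s.re) :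
    (F - G).derivative s = F.derivative s - G.derivative s := by
  have hopen : IsOpen {s : ℂ | 0 < s.re} := isOpen_lt continuous_const continuous_re
  ext i j
  exact deriv_sub ((F.2.1 i j).differentiableAt (hopen.mem_nhds hs))
    ((G.2.1 i j).differentiableAt (hopen.mem_nhds hs))

theorem trace_conjTranspose_vecMulVec_mul (u : Fin p → ℂ) (w : Fin m → ℂ)
    (N : Matrix (Fin p) (Fin m) ℂ) :
    Matrix.trace ((Matrix.vecMulVec u w)ᴴ * N) = star u ⬝ᵥ (N *ᵥ star w) := by
  rw [Matrix.conjTranspose_vecMulVec, Matrix.vecMulVec_mul, Matrix.trace_vecMulVec,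
    Matrix.dotProduct_mulVec, dotProduct_comm]

/-- Velocities of smooth curves through a function with simple poles `lam i` and residues
`c i (b i)*`. -/
theorem velocity_eq_of_poleResidue {r : ℕ} {G v : Hardy p m} (hG : G ∈ stableRational r m p)
    {lam : Fin r → ℂ} {b : Fin r → Fin m → ℂ} {c : Fin r → Fin p → ℂ}
    (hres : IsPoleResidueForm lam b c G) (hdist : Function.Injective lam)
    (hv : v ∈ tangentVectors (stableRational r m p) G) :
    (∀ i, (lam i).re < 0) ∧
    ∃ (P : Matrix (Fin p) (Fin r) ℂ) (S : Matrix (Fin r) (Fin m) ℂ) (Z : Matrix (Fin r) (Fin r) ℂ),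
      ∀ s : ℂ, 0 < s.re → v s =
        (∑ i, (s - lam i)⁻¹ • Matrix.vecMulVec (P.col i) (star (b i))) +
        (∑ i, (s - lam i)⁻¹ • Matrix.vecMulVec (c i) (S.row i)) +
        ∑ i, ∑ j, Z i j • ((s - lam i)⁻¹ * (s - lam j)⁻¹) •
          Matrix.vecMulVec (c i) (star (b j)) := by
  obtain ⟨A, B, C, hA, hmin, hGeq⟩ := hG
  have hres' : ∀ s : ℂ, 0 < s.re → (∀ i, s ≠ lam i) → transferFunction A B C s =
      ∑ i, (s - lam i)⁻¹ • Matrix.vecMulVec (c i) (star (b i)) := fun s hs hne =>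
    (hGeq s hs).symm.trans (hres s hs hne)
  have hne0 := residue_ne_zero hA hmin hres'
  have hre : ∀ i, (lam i).re < 0 := fun i => pole_re_neg hA hdist hres' (hne0 i)
  refine ⟨hre, ?_⟩
  have hlam : ∀ s : ℂ, 0 < s.re → ∀ i, s ≠ lam i := by
    rintro s hs i rfl
    exact absurd hs (not_lt.2 (hre i).le)
  -- From here `(diagonal lam, B₀, C₀)` replaces the minimal realization, so that the velocity comes
  -- out in terms of `b` and `c`.
  set B₀ : Matrix (Fin r) (Fin m) ℂ := Matrix.of fun i => star (b i) with hB₀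
  set C₀ : Matrix (Fin p) (Fin r) ℂ := Matrix.of fun k i => c i k with hC₀
  have hdiag : IsHurwitz (Matrix.diagonal lam) := by
    intro z hz
    rw [spectrum_diagonal] at hz
    obtain ⟨i, rfl⟩ := hz
    exact hre i
  have hb0 : ∀ i, B₀ i ≠ 0 := fun i h => hne0 i (by
    have : star (b i) = 0 := h
    rw [this]
    ext k l
    simp [Matrix.vecMulVec_apply])
  have hc0 : ∀ i, c i ≠ 0 := fun i h => hne0 i (by rw [h, Matrix.zero_vecMulVec])
  obtain ⟨x, hx⟩ := exists_forall_dotProduct_ne_zero hb0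
  obtain ⟨y, hy⟩ := exists_forall_dotProduct_ne_zero hc0
  obtain ⟨γ, ε, hε, hsmooth, hmem, hγ0, hγv⟩ := hv
  have hnhds : Set.Ioo (-ε) ε ∈ 𝓝 (0 : ℝ) := Ioo_mem_nhds (by linarith) hε
  have hderiv : HasDerivAt γ v 0 := by
    rw [← hγv]
    exact ((hsmooth.contDiffAt hnhds).differentiableAt (by simp)).hasDerivAt
  -- The sample points are `1, …, r` on the right and `r + 1, …, 2r` on the left: distinct and in
  -- the right half-plane.
  set τ : Fin r → ℂ := fun i => (((i : ℕ) + 1 : ℕ) : ℂ) with hτ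
  set θ : Fin r → ℂ := fun i => (((i : ℕ) + 1 + r : ℕ) : ℂ) with hθ
  have hτre : ∀ i, 0 < (τ i).re := fun i => by
    rw [hτ]; simp only [natCast_re]; positivity
  have hθre : ∀ i, 0 < (θ i).re := fun i => by
    rw [hθ]; simp only [natCast_re]; positivity
  have hτinj : Function.Injective τ := fun i j h => by
    have h' := Nat.cast_injective h
    ext; omega
  have hθinj : Function.Injective θ := fun i j h => by
    have h' := Nat.cast_injective h
    ext; omega
  have hne : ∀ i j, θ i ≠ τ j := fun i j h => by
    have h' := Nat.cast_injective h
    have := j.2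
    omega
  have hcurve : ∀ᶠ t in 𝓝 (0 : ℝ), ∃ (A : Matrix (Fin r) (Fin r) ℂ) (B : Matrix (Fin r) (Fin m) ℂ)
      (C : Matrix (Fin p) (Fin r) ℂ), IsHurwitz A ∧
        ∀ s : ℂ, 0 < s.re → γ t s = transferFunction A B C s := by
    filter_upwards [hnhds] with t ht
    obtain ⟨A', B', C', hA', -, hF⟩ := hmem t ht
    exact ⟨A', B', C', hA', hF⟩
  have hder : ∀ s i j, HasDerivAt (fun t => γ t s i j) (v s i j) 0 := by
    intro s i j
    rcases le_or_gt s.re 0 with hs | hs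
    · have e1 : (fun t => γ t s i j) = fun _ => 0 := funext fun t => by
        rw [apply_eq_zero (γ t) hs, Matrix.zero_apply]
      have e2 : v s i j = 0 := by rw [apply_eq_zero v hs, Matrix.zero_apply]
      rw [e1, e2]
      exact hasDerivAt_const _ _
    · exact hasDerivAt_eval hderiv hs i j
  have hstart : ∀ s : ℂ, 0 < s.re →
      γ 0 s = transferFunction (Matrix.diagonal lam) B₀ C₀ s := by
    intro s hs
    rw [hγ0, hres s hs (hlam s hs), transferFunction_diagonal (hlam s hs)]
    rfl
  obtain ⟨P, S, Z, hPSZ⟩ := Loewner.velocity_eq (F := fun t => γ t) (v := v) hcurve hder hdiag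
    hstart hτre hθre hne
    (Loewner.det_observe_diagonal_ne_zero hdist hθinj (fun i => hlam _ (hθre i)) (y := y) hy)
    (Loewner.det_reach_diagonal_ne_zero hdist hτinj (fun i => hlam _ (hτre i)) (x := x) hx)
  refine ⟨P, S, Z, fun s hs => ?_⟩
  have h3 : ∀ d : Fin r → ℂ, C₀ * Matrix.diagonal d * Z * Matrix.diagonal d * B₀ =
      ∑ i, ∑ j, Z i j • (d i * d j) • Matrix.vecMulVec (c i) (star (b j)) := by
    intro d
    ext k l
    have e : ∀ j, (C₀ * Matrix.diagonal d * Z) k j = ∑ i, C₀ k i * d i * Z i j := fun j => by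
      rw [Matrix.mul_apply]
      simp only [Matrix.mul_diagonal]
    rw [Matrix.mul_apply]
    simp only [Matrix.mul_diagonal, e, Matrix.sum_apply, Matrix.smul_apply,
      Matrix.vecMulVec_apply, smul_eq_mul, Finset.sum_mul]
    rw [Finset.sum_comm]
    refine Finset.sum_congr rfl fun i _ => Finset.sum_congr rfl fun j _ => ?_
    simp only [hB₀, hC₀, Matrix.of_apply]
    ring
  rw [hPSZ s hs, resolvent_diagonal (hlam s hs), h3, mul_diagonal_mul_eq_sum,
    mul_diagonal_mul_eq_sum]
  rfl

/-- The bitangential Hermite interpolation conditions make an interpolation error orthogonal to the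
velocities of curves through `∑ i, c i (b i)* / (s - lam i)`. -/
theorem inner_velocity_eq_zero {r : ℕ} {v E : Hardy p m} {lam : Fin r → ℂ}
    {b : Fin r → Fin m → ℂ} {c : Fin r → Fin p → ℂ} (hre : ∀ i, (lam i).re < 0)
    (hdist : Function.Injective lam) {P : Matrix (Fin p) (Fin r) ℂ} {S : Matrix (Fin r) (Fin m) ℂ}
    {Z : Matrix (Fin r) (Fin r) ℂ}
    (hv : ∀ s : ℂ, 0 < s.re → v s =
        (∑ i, (s - lam i)⁻¹ • Matrix.vecMulVec (P.col i) (star (b i))) +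
        (∑ i, (s - lam i)⁻¹ • Matrix.vecMulVec (c i) (S.row i)) +
        ∑ i, ∑ j, Z i j • ((s - lam i)⁻¹ * (s - lam j)⁻¹) •
          Matrix.vecMulVec (c i) (star (b j)))
    (hright : ∀ i, E (-conj (lam i)) *ᵥ b i = 0)
    (hleft : ∀ i, star (c i) ᵥ* E (-conj (lam i)) = 0)
    (hderiv : ∀ i, star (c i) ⬝ᵥ (E.derivative (-conj (lam i)) *ᵥ b i) = 0) :
    inner ℂ v E = 0 := by
  -- Elements of the Hardy space realizing `c i (b j)* / ((s - lam i)(s - lam j))`, by partial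
  -- fractions when `i ≠ j`.
  set Y : Fin r → Fin r → Hardy p m := fun i j =>
    if i = j then doublePole (hre i) (Matrix.vecMulVec (c i) (star (b i)))
    else (lam i - lam j)⁻¹ • (simplePole (hre i) (Matrix.vecMulVec (c i) (star (b j))) -
      simplePole (hre j) (Matrix.vecMulVec (c i) (star (b j)))) with hY
  have hYs : ∀ i j (s : ℂ), 0 < s.re → Y i j s =
      ((s - lam i)⁻¹ * (s - lam j)⁻¹) • Matrix.vecMulVec (c i) (star (b j)) := by
    intro i j s hs
    rw [← evalₗ_apply]
    simp only [hY]
    split_ifs with hij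
    · subst hij
      rw [evalₗ_apply, doublePole_apply _ _ hs, sq]
    · have h0 : lam i - lam j ≠ 0 := sub_ne_zero.2 fun h => hij (hdist h)
      have hi := sub_ne_zero_of_re (hre i) hs
      have hj := sub_ne_zero_of_re (hre j) hs
      rw [map_smul, map_sub, evalₗ_apply, evalₗ_apply, simplePole_apply _ _ hs,
        simplePole_apply _ _ hs, ← sub_smul, smul_smul]
      congr 1
      field_simp
      ring
  have hdecomp : v = (∑ i, simplePole (hre i) (Matrix.vecMulVec (P.col i) (star (b i)))) +
      (∑ i, simplePole (hre i) (Matrix.vecMulVec (c i) (S.row i))) +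
      ∑ i, ∑ j, Z i j • Y i j := by
    refine ext_of_re_pos fun s hs => ?_
    rw [hv s hs, ← evalₗ_apply]
    simp only [map_add, map_sum, map_smul]
    simp only [evalₗ_apply, simplePole_apply _ _ hs, hYs _ _ s hs]
  have hR : ∀ i (u : Fin p → ℂ),
      inner ℂ (simplePole (hre i) (Matrix.vecMulVec u (star (b i)))) E = 0 := by
    intro i u
    rw [inner_simplePole, trace_conjTranspose_vecMulVec_mul, star_star, hright, dotProduct_zero]
  have hL : ∀ i (w : Fin m → ℂ),
      inner ℂ (simplePole (hre i) (Matrix.vecMulVec (c i) w)) E = 0 := by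
    intro i w
    rw [inner_simplePole, trace_conjTranspose_vecMulVec_mul, Matrix.dotProduct_mulVec, hleft,
      zero_dotProduct]
  have hYin : ∀ i j, inner ℂ (Y i j) E = 0 := by
    intro i j
    simp only [hY]
    split_ifs with hij
    · rw [inner_doublePole, trace_conjTranspose_vecMulVec_mul, star_star, hderiv, neg_zero]
    -- The pole at `lam i` carries `c i` on the left and the pole at `lam j` carries `b j` on the
    -- right, so tangential conditions suffice off the diagonal.
    · rw [inner_smul_left, inner_sub_left, hL, hR, sub_zero, mul_zero]
  rw [hdecomp, inner_add_left, inner_add_left, sum_inner, sum_inner, sum_inner]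
  simp only [sum_inner, inner_smul_left, hR, hL, hYin, mul_zero, Finset.sum_const_zero, add_zero]

end Hardy

theorem mainTheorem7 {r m p : ℕ} (H Hk Hk' : Hardy p m)
    (hHk : Hk ∈ stableRational r m p) (hHk' : Hk' ∈ stableRational r m p)
    (lam : Fin r → ℂ) (b : Fin r → Fin m → ℂ) (c : Fin r → Fin p → ℂ)
    (hstep : IsIRKAStep lam b c H Hk Hk') (hdist : Function.Injective lam) :
    (∀ v ∈ tangentVectors (stableRational r m p) Hk, inner ℂ v (H - Hk') = 0) ∧
      IsProjectionAlongNormal (stableRational r m p) Hk H Hk' := by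
  have horth : ∀ v ∈ tangentVectors (stableRational r m p) Hk, inner ℂ v (H - Hk') = 0 := by
    intro v hv
    obtain ⟨hre, P, S, Z, hvs⟩ := Hardy.velocity_eq_of_poleResidue hHk hstep.1 hdist hv
    have hsub : ∀ s : ℂ, (H - Hk') s = H s - Hk' s := fun s => rfl
    refine Hardy.inner_velocity_eq_zero hre hdist hvs (fun i => ?_) (fun i => ?_) (fun i => ?_)
    · rw [hsub, Matrix.sub_mulVec, (hstep.2 i).1, sub_self]
    · rw [hsub, Matrix.vecMul_sub, (hstep.2 i).2.1, sub_self]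
    · rw [Hardy.derivative_sub H Hk' (by simpa using hre i), Matrix.sub_mulVec, dotProduct_sub,
        (hstep.2 i).2.2, sub_self]
  refine ⟨horth, hHk', ?_⟩
  rw [normalSpace, Submodule.mem_orthogonal]
  intro u hu
  induction hu using Submodule.span_induction with
  | mem v hv => exact horth v hv
  | zero => exact inner_zero_left _
  | add v w _ _ hv hw => rw [inner_add_left, hv, hw, add_zero]
  | smul a v _ hv => rw [inner_smul_left, hv, mul_zero]
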